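/- Let $\Gamma$ be a countable discrete group and let $\mu$ be a probability measure on $\Gamma$. Let $C^*_\lambda(\Gamma)\subset B(\ell^2(\Gamma))$ be the reduced $C^*$-algebra, the norm closure of the span of the left translations $\lambda_g$, and let $\tau_0(a)=\langle a\delta_e,\delta_e\rangle$ be its canonical trace. A state $\tau$ on $C^*_\lambda(\Gamma)$ is called $\mu$-stationary if $\sum_{g}\mu(g)\,\tau(\lambda_{g}^{-1}a\lambda_g)=\tau(a)$ for all $a\in C^*_\lambda(\Gamma)$. Suppose that $\mu$ is $C^*$-simple, i.e. that $\tau_0$ is the unique $\mu$-stationary state on $C^*_\lambda(\Gamma)$. Let $\Gamma$ act by measurable automorphisms on a probability space $(X,\nu)$ whose fixed-point sets $\{x: gx=x\}$, $g\in\Gamma$, are $\nu$-measurable (this is automatic if $X$ is a standard Borel space). Suppose that the action is non-singular ($g\nu$ and $\nu$ have the same null sets for every $g\in\Gamma$) and $\mu$-stationary ($\sum_{g}\mu(g)\,g\nu=\nu$). 1. If the stabilizer $\mathrm{Stab}_\Gamma(x)$ is amenable for $\nu$-almost every $x$, then the action is essentially free, i.e. $\mathrm{Stab}_\Gamma(x)=\{e\}$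 for $\nu$-almost every $x$. 2. In particular, if the action is Zimmer-amenable, i.e. if there is a $\Gamma$-equivariant conditional expectation $L^\infty(\Gamma\times X)\to L^\infty(X)$ (for the diagonal action on $\Gamma\times X$), then it is essentially free. 3. In particular, if $\mu$ is moreover generating (its support generates $\Gamma$ as a semigroup), then the action of $\Gamma$ on the Poisson boundary of $(\Gamma,\mu)$ is essentially free. Here a $\mu$-boundary is a non-singular $\mu$-stationary action on a probability space that is isomorphic, modulo null sets and as a measurable $\Gamma$-space, to a compact metrizable $\Gamma$-space $K$ with a $\mu$-stationary Borel probability measure $\kappa$ such that for almost every path $(\omega_n)$ of the $(\Gamma,\mu)$-random walk (started at $e$, with independent $\mu$-distributed increments multiplied on the right) $\omega_n\kappa$ converges weak* to a Dirac measure; and the Poisson boundary is the maximal $\mu$-boundary, i.e. the one of which every $\mu$-boundary is a measurable $\Gamma$-equivariant image. -/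

import Mathlib

open MeasureTheory Filter Topology
open scoped ENNReal ComplexOrder

universe u v

noncomputable section

/-! ### The reduced group C*-algebra -/

/-- The Hilbert space `ℓ²(Γ)`. -/
abbrev EllTwo (Γ : Type u) : Type u := lp (fun _ : Γ => ℂ) 2

theorem memℓp_translate {Γ : Type u} [Group Γ] (g : Γ) (f : EllTwo Γ) :
    Memℓp (fun h : Γ => f (g⁻¹ * h)) 2 := by
  have hf := (memℓp_gen_iff (by norm_num : 0 < (2 : ℝ≥0∞).toReal)).1 (lp.memℓp f)
  refine (memℓp_gen_iff (by norm_num : 0 < (2 : ℝ≥0∞).toReal)).2 ?_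
  exact (Equiv.mulLeft g⁻¹).summable_iff.2 hf

/-- Left translation `(λ_g ξ)(h) = ξ(g⁻¹h)` as an isometry of `ℓ²(Γ)`. -/
def leftRegularIsometry {Γ : Type u} [Group Γ] (g : Γ) : EllTwo Γ →ₗᵢ[ℂ] EllTwo Γ where
  toFun f := ⟨fun h : Γ => f (g⁻¹ * h), memℓp_translate g f⟩
  map_add' _ _ := rfl
  map_smul' _ _ := rfl
  norm_map' f := by
    have h2 : 0 < (2 : ℝ≥0∞).toReal := by norm_num
    change ‖(⟨fun h : Γ => f (g⁻¹ * h), memℓp_translate g f⟩ : EllTwo Γ)‖ = ‖f‖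
    rw [lp.norm_eq_tsum_rpow h2, lp.norm_eq_tsum_rpow h2]
    congr 1
    exact (Equiv.mulLeft g⁻¹).tsum_eq (fun h : Γ => ‖f h‖ ^ (2 : ℝ≥0∞).toReal)

/-- The left regular representation, `λ_g ∈ B(ℓ²(Γ))`. -/
def leftRegular {Γ : Type u} [Group Γ] (g : Γ) : EllTwo Γ →L[ℂ] EllTwo Γ :=
  (leftRegularIsometry g).toContinuousLinearMap

/-- The reduced C*-algebra `C*_λ(Γ)`: the norm closure in `B(ℓ²(Γ))` of the *-algebra generated
by the operators `λ_g` (which is their linear span, as these operators form a group of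
unitaries). -/
def reducedCStar (Γ : Type u) [Group Γ] : StarSubalgebra ℂ (EllTwo Γ →L[ℂ] EllTwo Γ) :=
  (StarAlgebra.adjoin ℂ (Set.range (leftRegular (Γ := Γ)))).topologicalClosure

/-- `λ_g` as an element of `C*_λ(Γ)`. -/
def reducedCStar.of {Γ : Type u} [Group Γ] (g : Γ) : reducedCStar Γ :=
  ⟨leftRegular g, StarSubalgebra.le_topologicalClosure _
    (StarAlgebra.subset_adjoin ℂ _ (Set.mem_range_self g))⟩

/-- A state on `C*_λ(Γ)`: a positive linear functional with value `1` at the unit. -/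
structure IsReducedState {Γ : Type u} [Group Γ] (τ : reducedCStar Γ →ₗ[ℂ] ℂ) : Prop where
  nonneg : ∀ a : reducedCStar Γ, 0 ≤ τ (star a * a)
  map_one : τ 1 = 1

open Classical in
/-- The canonical trace `τ₀(a) = ⟨a δ_e, δ_e⟩ = (a δ_e)(e)`, the continuous extension of
`∑ c_g λ_g ↦ c_e`. -/
def canonicalTrace (Γ : Type u) [Group Γ] : reducedCStar Γ →ₗ[ℂ] ℂ where
  toFun a := ((a : EllTwo Γ →L[ℂ] EllTwo Γ) (lp.single 2 (1 : Γ) (1 : ℂ))) (1 : Γ)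
  map_add' _ _ := rfl
  map_smul' _ _ := rfl

/-- `∑_g μ(g) gτ = τ` for the action of `Γ` by inner automorphisms, where
`(gτ)(a) = τ(λ_{g⁻¹} a λ_g)`. -/
def IsStationaryFunctional {Γ : Type u} [Group Γ] (μ : PMF Γ)
    (τ : reducedCStar Γ →ₗ[ℂ] ℂ) : Prop :=
  ∀ a : reducedCStar Γ, HasSum
    (fun g : Γ => (((μ g).toReal : ℝ) : ℂ) * τ (reducedCStar.of g⁻¹ * a * reducedCStar.of g)) (τ a)

/-- `μ` is a C*-simple measure: the canonical trace is the unique `μ`-stationary state on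
`C*_λ(Γ)`. -/
def IsCStarSimpleMeasure {Γ : Type u} [Group Γ] (μ : PMF Γ) : Prop :=
  ∀ τ : reducedCStar Γ →ₗ[ℂ] ℂ,
    (IsReducedState τ ∧ IsStationaryFunctional μ τ) ↔ τ = canonicalTrace Γ

/-! ### Measurable actions -/

/-- The discrete group `G` is amenable: there is a left-invariant mean on `ℓ^∞(G)`. -/
def IsAmenableGroup (G : Type u) [Group G] : Prop :=
  ∃ m : lp (fun _ : G => ℝ) ∞ →ₗ[ℝ] ℝ,
    m 1 = 1 ∧
    (∀ f : lp (fun _ : G => ℝ) ∞, (∀ h : G, 0 ≤ f h) → 0 ≤ m f) ∧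
    (∀ (g : G) (f f' : lp (fun _ : G => ℝ) ∞), (∀ h : G, f' h = f (g⁻¹ * h)) → m f' = m f)

/-- A (non-singular) `μ`-stationary action: `gν` and `ν` have the same null sets for every `g`,
and `∑_g μ(g) gν = ν`. -/
structure IsStationaryAction {Γ : Type u} [Group Γ] {X : Type v} [MeasurableSpace X]
    [MulAction Γ X] (μ : PMF Γ) (ν : Measure X) : Prop where
  map_ac : ∀ g : Γ, ν.map (fun x => g • x) ≪ ν
  ac_map : ∀ g : Γ, ν ≪ ν.map (fun x => g • x)
  stationary : Measure.sum (fun g : Γ => μ g • ν.map (fun x => g • x)) = ν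

/-- The stabilizer map `x ↦ Stab(x) ∈ 2^Γ` is `ν`-measurable, that is, every fixed-point set is
`ν`-measurable. -/
def HasMeasurableStabilizers (Γ : Type u) [Group Γ] {X : Type v} [MeasurableSpace X]
    [MulAction Γ X] (ν : Measure X) : Prop :=
  ∀ g : Γ, NullMeasurableSet {x : X | g • x = x} ν

/-- On a space with measurable diagonal (e.g. a standard Borel space) this is automatic. -/
theorem hasMeasurableStabilizers_of_measurableEq (Γ : Type u) [Group Γ] {X : Type v}
    [MeasurableSpace X] [MeasurableEq X] [MulAction Γ X] [MeasurableConstSMul Γ X]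
    (ν : Measure X) : HasMeasurableStabilizers Γ ν :=
  fun g => (measurableSet_eq_fun (measurable_const_smul g) measurable_id).nullMeasurableSet

/-- Almost every point has trivial stabilizer. -/
def IsEssentiallyFree (Γ : Type u) [Group Γ] {X : Type v} [MeasurableSpace X] [MulAction Γ X]
    (ν : Measure X) : Prop :=
  ∀ᵐ x ∂ν, MulAction.stabilizer Γ x = ⊥

/-- Almost every point has amenable stabilizer. -/
def HasAmenableStabilizers (Γ : Type u) [Group Γ] {X : Type v} [MeasurableSpace X]
    [MulAction Γ X] (ν : Measure X) : Prop :=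
  ∀ᵐ x ∂ν, IsAmenableGroup (MulAction.stabilizer Γ x)

/-- The product of counting measure on `Γ` (with all subsets measurable) and `ν`. -/
def countProd (Γ : Type u) {X : Type v} [MeasurableSpace X] (ν : Measure X) :
    @Measure (Γ × X) (@Prod.instMeasurableSpace Γ X ⊤ _) :=
  letI : MeasurableSpace Γ := ⊤
  (Measure.count : Measure Γ).prod ν

/-- The space `L^∞(Γ × X)`. -/
abbrev LInftyProd (Γ : Type u) {X : Type v} [MeasurableSpace X] (ν : Measure X) :=
  @Lp (Γ × X) ℝ (@Prod.instMeasurableSpace Γ X ⊤ _) _ ∞ (countProd Γ ν)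

/-- Zimmer amenability of a non-singular action: there is a `Γ`-equivariant conditional
expectation `P : L^∞(Γ × X) → L^∞(X)`, where `Γ` acts diagonally on `Γ × X`. That is, `P` is
linear, unital, positive, `L^∞(X)`-linear and equivariant. -/
def IsZimmerAmenable (Γ : Type u) [Group Γ] {X : Type v} [MeasurableSpace X] [MulAction Γ X]
    (ν : Measure X) : Prop :=
  ∃ P : LInftyProd Γ ν →ₗ[ℝ] Lp ℝ ∞ ν,
    (∀ F : LInftyProd Γ ν, (∀ᵐ p ∂(countProd Γ ν), F p = 1) → ∀ᵐ x ∂ν, P F x = 1) ∧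
    (∀ F : LInftyProd Γ ν, (∀ᵐ p ∂(countProd Γ ν), 0 ≤ F p) → ∀ᵐ x ∂ν, 0 ≤ P F x) ∧
    (∀ (F F' : LInftyProd Γ ν) (f : Lp ℝ ∞ ν),
      (∀ᵐ p ∂(countProd Γ ν), F' p = f p.2 * F p) → ∀ᵐ x ∂ν, P F' x = f x * P F x) ∧
    (∀ (g : Γ) (F F' : LInftyProd Γ ν),
      (∀ᵐ p ∂(countProd Γ ν), F' p = F (g⁻¹ * p.1, g⁻¹ • p.2)) →
        ∀ᵐ x ∂ν, P F' x = P F (g⁻¹ • x))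

/-! ### The Poisson boundary -/

/-- `μ` is generating: its support generates `Γ` as a semigroup. -/
def IsGenerating {Γ : Type u} [Group Γ] (μ : PMF Γ) : Prop :=
  Subsemigroup.closure μ.support = ⊤

/-- The position `s₀ s₁ ⋯ s_{n-1}` at time `n` of the walk with increments `s`. -/
def walkPosition {Γ : Type u} [Group Γ] (s : ℕ → Γ) : ℕ → Γ
  | 0 => 1
  | n + 1 => walkPosition s n * s n

/-- The Bernoulli measure `μ × μ × ⋯`, the law of the increments of the `(Γ, μ)`-random walk. -/
def incrementLaw {Γ : Type u} (μ : PMF Γ) :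
    @Measure (ℕ → Γ) (@MeasurableSpace.pi ℕ (fun _ => Γ) (fun _ => ⊤)) :=
  letI : MeasurableSpace Γ := ⊤
  Measure.infinitePi (fun _ : ℕ => μ.toMeasure)

/-- A `μ`-boundary on a compact metrizable `Γ`-space: `ν` is stationary and for almost every path
`ω` of the random walk `ω_n ν` converges weak* to a Dirac measure. -/
structure IsCompactMuBoundary {Γ : Type u} [Group Γ] {K : Type v} [TopologicalSpace K]
    [MeasurableSpace K] [MulAction Γ K] (μ : PMF Γ) (ν : Measure K) : Prop where
  isStationary : IsStationaryAction μ ν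
  tendsto_dirac : ∀ᵐ s ∂(incrementLaw μ), ∃ x : K, ∀ f : C(K, ℝ),
    Tendsto (fun n : ℕ => ∫ y, f (walkPosition s n • y) ∂ν) atTop (𝓝 (f x))

/-- `(Y, η)` is a measurable `Γ`-equivariant image of `(X, ν)`, through the map `φ`. -/
structure IsFactorMap (Γ : Type u) [Group Γ] {X Y : Type*} [MeasurableSpace X]
    [MeasurableSpace Y] [MulAction Γ X] [MulAction Γ Y] (ν : Measure X) (η : Measure Y)
    (φ : X → Y) : Prop where
  measurable : Measurable φ
  map_eq : ν.map φ = η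
  equivariant : ∀ g : Γ, ∀ᵐ x ∂ν, φ (g • x) = g • φ x

/-- `(X, ν)` and `(Y, η)` are measurably isomorphic as `Γ`-spaces (modulo null sets). -/
def AreIsomorphicActions (Γ : Type u) [Group Γ] {X Y : Type*} [MeasurableSpace X]
    [MeasurableSpace Y] [MulAction Γ X] [MulAction Γ Y] (ν : Measure X) (η : Measure Y) : Prop :=
  ∃ (φ : X → Y) (ψ : Y → X), IsFactorMap Γ ν η φ ∧ IsFactorMap Γ η ν ψ ∧
    (∀ᵐ x ∂ν, ψ (φ x) = x) ∧ (∀ᵐ y ∂η, φ (ψ y) = y)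

/-- A `μ`-boundary in the measurable setting: a `μ`-stationary action that has a compact
metrizable model which is a `μ`-boundary. Compact metrizable spaces have at most continuum many
points, so the universe in which models are taken makes no difference. -/
def IsMuBoundary {Γ : Type u} [Group Γ] {X : Type v} [MeasurableSpace X] [MulAction Γ X]
    (μ : PMF Γ) (ν : Measure X) : Prop :=
  IsStationaryAction μ ν ∧
  ∃ (K : Type u) (_ : TopologicalSpace K) (_ : CompactSpace K)
    (_ : TopologicalSpace.MetrizableSpace K) (_ : MeasurableSpace K) (_ : BorelSpace K)
    (_ : MulAction Γ K) (_ : ContinuousConstSMul Γ K) (κ : Measure K)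
    (_ : IsProbabilityMeasure κ),
    IsCompactMuBoundary μ κ ∧ AreIsomorphicActions Γ ν κ

/-- `(X, ν)` is (a realization of) the Poisson boundary of `(Γ, μ)`: it is a `μ`-boundary, and
every `μ`-boundary is a measurable `Γ`-equivariant image of it. As every `μ`-boundary is
isomorphic to a compact metrizable one, only those are mentioned. -/
def IsPoissonBoundary {Γ : Type u} [Group Γ] {X : Type v} [MeasurableSpace X] [MulAction Γ X]
    (μ : PMF Γ) (ν : Measure X) : Prop :=
  IsMuBoundary μ ν ∧
  ∀ (K : Type u) [TopologicalSpace K] [CompactSpace K] [TopologicalSpace.MetrizableSpace K]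
    [MeasurableSpace K] [BorelSpace K] [MulAction Γ K] [ContinuousConstSMul Γ K]
    (κ : Measure K) [IsProbabilityMeasure κ],
    IsCompactMuBoundary μ κ → ∃ φ : X → K, IsFactorMap Γ ν κ φ

end

/-! Put `t g = ν(Fix g)`, the average over `x` of the indicator functions of the stabilizers. Each
indicator of a subgroup is positive definite, hence so is `t`. Since `Fix (g⁻¹hg) = g⁻¹ Fix h`,
stationarity of `ν` makes `t` stationary under conjugation. If the stabilizers are amenable, their
indicators are pointwise limits of coefficients of the regular representation, so `|∑ c_g t(g)| ≤ ‖∑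
c_g λ_g‖`, and `t` extends to a `μ`-stationary state on `C*_λ(Γ)`. By C*-simplicity this state is
the canonical trace, so `ν(Fix g) = 0` for `g ≠ e`, and countability of `Γ` gives essential
freeness. This is `isEssentiallyFree_of_almostInvariantVectors`.

The only form of amenability needed is local: for almost every `x`, each finite `F` fixing `x` has
almost invariant vectors. As there are countably many `F`, one may fix an `F` without such vectors
and show that almost no point is fixed by all of `F`. For such an `F`, Hahn-Banach separation in
`ℓ¹` yields bounded functions `f_g` with `∑_g (f_g(gh) - f_g(h)) ≥ δ > 0` for all `h`
(`hasNonamenabilityWitness_of_not`). All three parts contradict this inequality at a point fixed by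
`F`, by a positive averaging that does not distinguish `f_g(g ·)` from `f_g` there.

For amenable stabilizers the averaging is an invariant mean. For Zimmer-amenable actions it is the
equivariant expectation evaluated at the fixed point. For the Poisson boundary the `f_g` are first
made harmonic; their limits along the random walk define a compact `μ`-boundary, onto which the
Poisson boundary maps equivariantly, and the inequality survives as one between boundary values.
Thus no amenability of the Poisson action has to be established beforehand. -/

/-! ### Almost invariant vectors -/

/-- The finite set `F` has almost invariant unit vectors in `ℓ²` of the subgroup it generates. -/
def HasAlmostInvariantVectors {Γ : Type u} [Group Γ] (F : Finset Γ) : Prop :=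
  ∀ ε : ℝ, 0 < ε → ∃ η : EllTwo Γ, ‖η‖ = 1 ∧
    (∀ h : Γ, h ∉ Subgroup.closure (F : Set Γ) → η h = 0) ∧
    ∀ g ∈ F, ‖leftRegular g η - η‖ ≤ ε

/-- Bounded functions `f_g`, `g ∈ F`, such that `∑_g (g⁻¹f_g - f_g)` is bounded below by a positive
constant. -/
def HasNonamenabilityWitness {Γ : Type u} [Group Γ] (F : Finset Γ) : Prop :=
  ∃ (f : F → Γ → ℝ) (C δ : ℝ), (∀ g h, |f g h| ≤ C) ∧ 0 < δ ∧
    ∀ h : Γ, δ ≤ ∑ g : F, (f g (g * h) - f g h)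

theorem leftRegular_apply {Γ : Type u} [Group Γ] (g : Γ) (f : EllTwo Γ) (h : Γ) :
    leftRegular g f h = f (g⁻¹ * h) := rfl

theorem Real.sq_sqrt_sub_sqrt_le {a b : ℝ} (ha : 0 ≤ a) (hb : 0 ≤ b) :
    (√a - √b) ^ 2 ≤ |a - b| := by
  have h1 := Real.sq_sqrt ha
  have h2 := Real.sq_sqrt hb
  have h3 := Real.sqrt_nonneg a
  have h4 := Real.sqrt_nonneg b
  have h5 : a - b = (√a - √b) * (√a + √b) := by nlinarith
  rw [h5, abs_mul, abs_of_nonneg (add_nonneg h3 h4), ← sq_abs, sq]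
  refine mul_le_mul_of_nonneg_left ?_ (abs_nonneg _)
  rw [abs_le]
  constructor <;> linarith

open Classical in
/-- The finite convex combinations of the vectors `(δ_{gh} - δ_h)_g` are of the form `(gξ - ξ)_g`
with a probability vector `ξ`. -/
theorem convexHull_range_translation_difference {Γ : Type u} [Group Γ] (F : Finset Γ)
    (H : Subgroup Γ) {c : F → lp (fun _ : Γ => ℝ) 1}
    (hc : c ∈ convexHull ℝ (Set.range fun (h : H) (g : F) =>
      (lp.single 1 ((g : Γ) * (h : Γ)) (1 : ℝ) - lp.single 1 (h : Γ) (1 : ℝ) :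
        lp (fun _ : Γ => ℝ) 1))) :
    ∃ ξ : Γ → ℝ, (∀ h, 0 ≤ ξ h) ∧ HasSum ξ 1 ∧ (∀ h, h ∉ H → ξ h = 0) ∧
      ∀ (g : F) (h : Γ), c g h = ξ ((g : Γ)⁻¹ * h) - ξ h := by
  let A : Set (F → lp (fun _ : Γ => ℝ) 1) := {c | ∃ ξ : Γ → ℝ, (∀ h, 0 ≤ ξ h) ∧ HasSum ξ 1 ∧
    (∀ h, h ∉ H → ξ h = 0) ∧ ∀ (g : F) (h : Γ), c g h = ξ ((g : Γ)⁻¹ * h) - ξ h}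
  refine (convexHull_min (t := A) ?_ ?_) hc
  · rintro _ ⟨k, rfl⟩
    refine ⟨fun h => if h = k then 1 else 0, fun h => by positivity,
      by simpa using hasSum_ite_eq (k : Γ) (1 : ℝ), fun h hh => if_neg ?_, fun g h => ?_⟩
    · rintro rfl
      exact hh k.2
    · change (Pi.single ((g : Γ) * (k : Γ)) (1 : ℝ) : Γ → ℝ) h - (Pi.single (k : Γ) (1 : ℝ) : Γ → ℝ) h = _
      simp [Pi.single_apply, inv_mul_eq_iff_eq_mul]
  · rintro c₁ ⟨ξ₁, h1, h2, h3, h4⟩ c₂ ⟨ξ₂, k1, k2, k3, k4⟩ a b ha hb hab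
    refine ⟨fun h => a * ξ₁ h + b * ξ₂ h, fun h => ?_, ?_, fun h hh => ?_, fun g h => ?_⟩
    · have := h1 h
      have := k1 h
      positivity
    · simpa [hab] using (h2.mul_left a).add (k2.mul_left b)
    · simp [h3 h hh, k3 h hh]
    · change a * c₁ g h + b * c₂ g h = _
      rw [h4 g h, k4 g h]
      ring

/-- Take `η = √ξ`: the inequality `(√a - √b)² ≤ |a - b|` turns `ℓ¹`-almost invariance of `ξ` with
error `ε²` into `ℓ²`-almost invariance of `η` with error `ε`. -/
theorem exists_vector_of_probability {Γ : Type u} [Group Γ] (F : Finset Γ) (H : Subgroup Γ)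
    {ε : ℝ} (hε : 0 ≤ ε) (ξ : Γ → ℝ) (h0 : ∀ h, 0 ≤ ξ h) (h1 : HasSum ξ 1)
    (hH : ∀ h, h ∉ H → ξ h = 0)
    (hF : ∀ g ∈ F, ∃ s, s ≤ ε ^ 2 ∧ HasSum (fun h => |ξ (g⁻¹ * h) - ξ h|) s) :
    ∃ η : EllTwo Γ, ‖η‖ = 1 ∧ (∀ h : Γ, h ∉ H → η h = 0) ∧
      ∀ g ∈ F, ‖leftRegular g η - η‖ ≤ ε := by
  have hp : 0 < (2 : ℝ≥0∞).toReal := by norm_num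
  have hsq : ∀ h, ‖((√(ξ h) : ℝ) : ℂ)‖ ^ (2 : ℝ≥0∞).toReal = ξ h := fun h => by
    rw [Complex.norm_real, Real.norm_of_nonneg (Real.sqrt_nonneg _)]
    simpa using Real.sq_sqrt (h0 h)
  let η : EllTwo Γ := ⟨fun h => ((√(ξ h) : ℝ) : ℂ), (memℓp_gen_iff hp).2 (by
    simp_rw [hsq]; exact h1.summable)⟩
  have hη : ∀ h, η h = ((√(ξ h) : ℝ) : ℂ) := fun h => rfl
  refine ⟨η, ?_, fun h hh => by simp [hη, hH h hh], fun g hg => ?_⟩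
  · rw [lp.norm_eq_tsum_rpow hp]
    simp_rw [hη, hsq, h1.tsum_eq]
    simp
  · obtain ⟨s, hs, hsum⟩ := hF g hg
    have h2 := lp.hasSum_norm hp (leftRegular g η - η)
    have h3 : ‖leftRegular g η - η‖ ^ (2 : ℝ≥0∞).toReal ≤ s := by
      refine hasSum_le (fun h => ?_) h2 hsum
      rw [lp.coeFn_sub, Pi.sub_apply, leftRegular_apply, hη, hη, ← Complex.ofReal_sub,
        Complex.norm_real]
      simpa using Real.sq_sqrt_sub_sqrt_le (h0 (g⁻¹ * h)) (h0 h)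
    have h4 : ‖leftRegular g η - η‖ ^ 2 ≤ ε ^ 2 := by
      refine le_trans ?_ hs
      simpa using h3
    exact abs_le_of_sq_le_sq' h4 hε |>.2

/-- A left `H`-equivariant map `Γ → H`. -/
theorem Subgroup.exists_equivariant_retraction {Γ : Type u} [Group Γ] (H : Subgroup Γ) :
    ∃ p : Γ → H, ∀ (g : H) (k : Γ), p (g * k) = g * p k := by
  let π : Γ → Quotient (QuotientGroup.rightRel H) := Quotient.mk _
  have hπ : ∀ k : Γ, k * (π k).out⁻¹ ∈ H := fun k => by
    have : (QuotientGroup.rightRel H) ((π k).out) k := Quotient.exact (Quotient.out_eq (π k))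
    exact QuotientGroup.rightRel_apply.1 this
  refine ⟨fun k => ⟨k * (π k).out⁻¹, hπ k⟩, fun g k => Subtype.ext ?_⟩
  have : π (g * k) = π k := Quotient.sound (by
    change (QuotientGroup.rightRel H) _ _
    rw [QuotientGroup.rightRel_apply]
    simp)
  simp [this, mul_assoc]

-- Either the convex hull of the tuples `(δ_{gh} - δ_h)_g` has `0` in its norm closure, which gives
-- almost invariant probability vectors, or a continuous functional separates it from `0`. By the
-- duality of `ℓ¹` and `ℓ^∞` that functional is a family of bounded functions.
open Classical in
theorem hasNonamenabilityWitness_of_not {Γ : Type u} [Group Γ] (F : Finset Γ)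
    (hF : ¬ HasAlmostInvariantVectors F) : HasNonamenabilityWitness F := by
  let H := Subgroup.closure (F : Set Γ)
  let D : H → F → lp (fun _ : Γ => ℝ) 1 := fun h g =>
    lp.single 1 ((g : Γ) * (h : Γ)) (1 : ℝ) - lp.single 1 (h : Γ) (1 : ℝ)
  by_cases h0 : (0 : F → lp (fun _ : Γ => ℝ) 1) ∈ closure (convexHull ℝ (Set.range D))
  · refine absurd (fun ε hε => ?_) hF
    obtain ⟨c, hc, hcε⟩ := Metric.mem_closure_iff.1 h0 (ε ^ 2) (by positivity)
    obtain ⟨ξ, h1, h2, h3, h4⟩ := convexHull_range_translation_difference F H hc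
    refine exists_vector_of_probability F H hε.le ξ h1 h2 h3 fun g hg => ⟨‖c ⟨g, hg⟩‖, ?_, ?_⟩
    · rw [dist_zero_left] at hcε
      exact (norm_le_pi_norm c _).trans hcε.le
    · have := lp.hasSum_norm (p := 1) (by norm_num) (c ⟨g, hg⟩)
      simpa [h4] using this
  · obtain ⟨φ, u, hu, hφ⟩ := geometric_hahn_banach_point_closed
      (convex_convexHull ℝ (Set.range D)).closure isClosed_closure h0
    rw [map_zero] at hu
    -- The separation only speaks of `h ∈ H`; composing with an `H`-equivariant map `Γ → H` spreads
    -- the inequality over all of `Γ`.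
    obtain ⟨p, hp⟩ := H.exists_equivariant_retraction
    let f : F → Γ → ℝ := fun g h => φ (Pi.single g (lp.single 1 h (1 : ℝ)))
    refine ⟨fun g k => f g (p k), ‖φ‖, u, fun g k => ?_, hu, fun k => ?_⟩
    · refine (φ.le_opNorm _).trans ?_
      rw [Pi.norm_single, lp.norm_single (by norm_num)]
      simp
    · have h2 := (hφ (D (p k)) (subset_closure (subset_convexHull ℝ _ ⟨p k, rfl⟩))).le
      rw [← Finset.univ_sum_single (D (p k)), map_sum] at h2
      refine h2.trans_eq (Finset.sum_congr rfl fun g _ => ?_)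
      have hg : (g : Γ) ∈ H := Subgroup.subset_closure g.2
      have h3 : p (g * k) = ⟨g, hg⟩ * p k := hp ⟨g, hg⟩ k
      change φ (Pi.single g (_ - _)) = f g (p (g * k)) - f g (p k)
      rw [Pi.single_sub, map_sub, h3]
      rfl

open Classical in
/-- If the finite subsets of `H` have almost invariant vectors, then summation over `H` is bounded
by the norm in the reduced C*-algebra. -/
theorem norm_sum_subgroup_le {Γ : Type u} [Group Γ] (H : Subgroup Γ)
    (hH : ∀ F : Finset Γ, (∀ g ∈ F, g ∈ H) → HasAlmostInvariantVectors F)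
    (S : Finset Γ) (c : Γ → ℂ) :
    ‖∑ g ∈ S, c g * (if g ∈ H then 1 else 0)‖ ≤ ‖∑ g ∈ S, c g • leftRegular (Γ := Γ) g‖ := by
  set T : EllTwo Γ →L[ℂ] EllTwo Γ := ∑ g ∈ S, c g • leftRegular (Γ := Γ) g with hT
  refine le_of_forall_pos_le_add fun ε hε => ?_
  let M : ℝ := ∑ g ∈ S, ‖c g‖
  have hM : 0 ≤ M := Finset.sum_nonneg fun _ _ => norm_nonneg _
  let F := S.filter (· ∈ H)
  -- The coefficient `⟨η, λ_g η⟩` is nearly `1` for `g ∈ F` and exactly `0` for `g ∉ H`, where the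
  -- supports of `η` and `λ_g η` are disjoint. The `+ 1` covers `M = 0`.
  obtain ⟨η, h1, h2, h3⟩ := hH F (fun g hg => (Finset.mem_filter.1 hg).2) (ε / (M + 1))
    (by positivity)
  have hFH : Subgroup.closure (F : Set Γ) ≤ H :=
    (Subgroup.closure_le H).2 fun g hg => (Finset.mem_filter.1 hg).2
  have key : ∀ g ∈ S, ‖(if g ∈ H then (1 : ℂ) else 0) - inner ℂ η (leftRegular g η)‖
      ≤ ε / (M + 1) := by
    intro g hg
    split_ifs with hgH
    · have e1 : inner ℂ η η = (1 : ℂ) := by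
        rw [inner_self_eq_norm_sq_to_K, h1]
        simp
      rw [← e1, ← inner_sub_right]
      refine (norm_inner_le_norm _ _).trans ?_
      rw [h1, one_mul, norm_sub_rev]
      exact h3 g (Finset.mem_filter.2 ⟨hg, hgH⟩)
    · rw [lp.inner_eq_tsum]
      have : ∀ h, inner ℂ (η h) (leftRegular g η h) = (0 : ℂ) := by
        intro h
        by_cases hh : h ∈ Subgroup.closure (F : Set Γ)
        · have : g⁻¹ * h ∉ Subgroup.closure (F : Set Γ) := fun h' => hgH (by
            have := H.mul_mem (hFH hh) (H.inv_mem (hFH h'))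
            simpa using this)
          rw [leftRegular_apply, h2 _ this, inner_zero_right]
        · rw [h2 _ hh, inner_zero_left]
      simp only [this, tsum_zero, sub_zero, norm_zero]
      positivity
  have e2 : inner ℂ η (T η) = ∑ g ∈ S, c g * inner ℂ η (leftRegular g η) := by
    simp only [hT, sum_apply, inner_sum, smul_apply, inner_smul_right]
  have e3 : ‖inner ℂ η (T η)‖ ≤ ‖T‖ := by
    refine (norm_inner_le_norm _ _).trans ?_
    have := T.le_opNorm η
    rw [h1] at this ⊢
    linarith
  have e4 : ‖∑ g ∈ S, c g * (if g ∈ H then (1 : ℂ) else 0) - inner ℂ η (T η)‖ ≤ ε := by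
    rw [e2, ← Finset.sum_sub_distrib]
    calc _ ≤ ∑ g ∈ S, ‖c g‖ * (ε / (M + 1)) := by
          refine norm_sum_le_of_le _ fun g hg => ?_
          rw [← mul_sub, norm_mul]
          exact mul_le_mul_of_nonneg_left (key g hg) (norm_nonneg _)
      _ = M * (ε / (M + 1)) := by rw [← Finset.sum_mul]
      _ ≤ ε := by
        rw [mul_div_assoc', div_le_iff₀ (by positivity)]
        nlinarith
  calc _ ≤ ‖inner ℂ η (T η)‖ + ‖∑ g ∈ S, c g * (if g ∈ H then (1 : ℂ) else 0)
        - inner ℂ η (T η)‖ := norm_le_norm_add_norm_sub' _ _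
    _ ≤ _ := add_le_add e3 e4

/-! ### Functionals on the reduced C*-algebra given by coefficient functions -/

theorem leftRegular_one {Γ : Type u} [Group Γ] : leftRegular (1 : Γ) = 1 := by
  ext f h
  simp [leftRegular_apply]

theorem leftRegular_mul {Γ : Type u} [Group Γ] (g h : Γ) :
    leftRegular (g * h) = leftRegular g * leftRegular h := by
  ext f k
  simp [leftRegular_apply, mul_assoc]

theorem norm_leftRegular_le {Γ : Type u} [Group Γ] (g : Γ) : ‖leftRegular g‖ ≤ 1 :=
  (leftRegularIsometry g).norm_toContinuousLinearMap_le

theorem star_leftRegular {Γ : Type u} [Group Γ] (g : Γ) :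
    star (leftRegular g) = leftRegular g⁻¹ := by
  rw [ContinuousLinearMap.star_eq_adjoint, eq_comm, ContinuousLinearMap.eq_adjoint_iff]
  intro x y
  have h1 := (leftRegularIsometry g).inner_map_map (leftRegular g⁻¹ x) y
  rw [← h1]
  congr 1
  have : leftRegular g (leftRegular g⁻¹ x) = (leftRegular g * leftRegular g⁻¹) x := rfl
  rw [← leftRegular_mul, mul_inv_cancel, leftRegular_one] at this
  exact this

/-- `c ↦ ∑_g c_g λ_g`. -/
noncomputable def regularCombination (Γ : Type u) [Group Γ] :
    (Γ →₀ ℂ) →ₗ[ℂ] (EllTwo Γ →L[ℂ] EllTwo Γ) :=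
  Finsupp.linearCombination ℂ leftRegular

theorem regularCombination_apply {Γ : Type u} [Group Γ] (c : Γ →₀ ℂ) :
    regularCombination Γ c = ∑ g ∈ c.support, c g • leftRegular (Γ := Γ) g := rfl

theorem regularCombination_single {Γ : Type u} [Group Γ] (g : Γ) :
    regularCombination Γ (Finsupp.single g 1) = leftRegular g := by
  simp [regularCombination]

open Classical in
theorem leftRegular_apply_single {Γ : Type u} [Group Γ] (g h : Γ) :
    leftRegular g (lp.single 2 (1 : Γ) (1 : ℂ)) h = if h = g then 1 else 0 := by
  rw [leftRegular_apply, lp.coeFn_single, Pi.single_apply]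
  simp [inv_mul_eq_one, eq_comm]

open Classical in
theorem regularCombination_apply_single {Γ : Type u} [Group Γ] (c : Γ →₀ ℂ) (h : Γ) :
    regularCombination Γ c (lp.single 2 (1 : Γ) (1 : ℂ)) h = c h := by
  rw [regularCombination_apply]
  simp only [sum_apply, smul_apply, lp.coeFn_sum, Finset.sum_apply, lp.coeFn_smul, Pi.smul_apply,
    leftRegular_apply_single]
  simp [eq_comm]

theorem regularCombination_injective (Γ : Type u) [Group Γ] :
    Function.Injective (regularCombination Γ) := by
  classical
  intro c d h
  ext g
  rw [← regularCombination_apply_single, h, regularCombination_apply_single]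

/-- The `λ_g` are closed under products and adjoints, so the *-algebra they generate is just their
span. -/
theorem mem_closure_range_regularCombination {Γ : Type u} [Group Γ] (a : reducedCStar Γ) :
    (a : EllTwo Γ →L[ℂ] EllTwo Γ) ∈ closure (Set.range (regularCombination Γ)) := by
  have h1 := a.2
  refine closure_mono ?_ h1
  intro b hb
  let ρ : Γ →* (EllTwo Γ →L[ℂ] EllTwo Γ) := ⟨⟨leftRegular, leftRegular_one⟩, leftRegular_mul⟩
  have hb' : b ∈ Subalgebra.toSubmodule (StarAlgebra.adjoin ℂ
    (Set.range (leftRegular (Γ := Γ)))).toSubalgebra := hb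
  rw [StarAlgebra.adjoin_eq_span] at hb'
  have h2 : Set.range (leftRegular (Γ := Γ)) ∪ star (Set.range (leftRegular (Γ := Γ)))
      = MonoidHom.mrange ρ := by
    refine (Set.union_eq_left.2 ?_).trans rfl
    rintro x ⟨g, hg⟩
    exact ⟨g⁻¹, by rw [← star_leftRegular, hg, star_star]⟩
  rw [h2, Submonoid.closure_eq] at hb'
  have h3 : ((MonoidHom.mrange ρ : Submonoid _) : Set (EllTwo Γ →L[ℂ] EllTwo Γ))
    = Set.range leftRegular := rfl
  rw [h3, ← Finsupp.range_linearCombination] at hb'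
  exact hb'

/-- A function on `Γ` that is bounded with respect to the norm of `C*_λ(Γ)` extends. -/
theorem exists_functional_of_bound {Γ : Type u} [Group Γ] (t : Γ → ℂ)
    (ht : ∀ c : Γ →₀ ℂ, ‖∑ g ∈ c.support, c g * t g‖ ≤ ‖regularCombination Γ c‖) :
    ∃ φ : StrongDual ℂ (EllTwo Γ →L[ℂ] EllTwo Γ), ∀ g, φ (leftRegular g) = t g := by
  -- Linear independence of the `λ_g` makes `∑ c_g λ_g ↦ ∑ c_g t(g)` well defined; Hahn-Banach then
  -- extends it to all of `B(ℓ²(Γ))`.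
  let e := LinearEquiv.ofInjective (regularCombination Γ) (regularCombination_injective Γ)
  let f : LinearMap.range (regularCombination Γ) →ₗ[ℂ] ℂ :=
    (Finsupp.linearCombination ℂ t).comp e.symm.toLinearMap
  have hf : ∀ x, ‖f x‖ ≤ 1 * ‖x‖ := by
    intro x
    obtain ⟨c, rfl⟩ := e.surjective x
    have h1 : f (e c) = ∑ g ∈ c.support, c g * t g := by
      change Finsupp.linearCombination ℂ t (e.symm (e c)) = _
      rw [e.symm_apply_apply]
      rfl
    rw [one_mul, h1]
    exact ht c
  obtain ⟨φ, hφ, -⟩ := exists_extension_norm_eq _ (f.mkContinuous 1 hf)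
  refine ⟨φ, fun g => ?_⟩
  have h1 := hφ (e (Finsupp.single g 1))
  have h2 : ((e (Finsupp.single g 1) : LinearMap.range (regularCombination Γ)) :
      EllTwo Γ →L[ℂ] EllTwo Γ) = leftRegular g := regularCombination_single g
  rw [h2] at h1
  rw [h1]
  change Finsupp.linearCombination ℂ t (e.symm (e _)) = _
  rw [e.symm_apply_apply]
  simp

theorem star_regularCombination_mul_self {Γ : Type u} [Group Γ] (c : Γ →₀ ℂ) :
    star (regularCombination Γ c) * regularCombination Γ c =
      ∑ g ∈ c.support, ∑ h ∈ c.support, (star (c g) * c h) • leftRegular (Γ := Γ) (g⁻¹ * h) := by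
  simp only [regularCombination_apply, star_sum, Finset.sum_mul_sum, star_smul, star_leftRegular,
    smul_mul_smul_comm, leftRegular_mul]

/-- The series converges absolutely in the dual norm. The averaged functional is therefore
continuous, so stationarity need only be tested on a set with dense span. -/
theorem exists_hasSum_conj {ι A : Type*} [NormedRing A] [NormedAlgebra ℂ A] (w : ι → ℝ)
    (hw : ∀ i, 0 ≤ w i) (hws : Summable w) (U V : ι → A) (hU : ∀ i, ‖U i‖ ≤ 1)
    (hV : ∀ i, ‖V i‖ ≤ 1) (φ : StrongDual ℂ A) :
    ∃ Ψ : StrongDual ℂ A, ∀ b, HasSum (fun i => (w i : ℂ) * φ (U i * b * V i)) (Ψ b) := by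
  let Φ : ι → StrongDual ℂ A := fun i =>
    (w i : ℂ) • φ.comp (ContinuousLinearMap.mulLeftRight ℂ A (U i) (V i))
  have hs : Summable Φ := by
    refine Summable.of_norm_bounded (g := fun i => w i * ‖φ‖) (hws.mul_right _) fun i => ?_
    rw [norm_smul, Complex.norm_real, Real.norm_of_nonneg (hw i)]
    refine mul_le_mul_of_nonneg_left ?_ (hw i)
    refine (ContinuousLinearMap.opNorm_comp_le _ _).trans ?_
    refine mul_le_of_le_one_right (norm_nonneg _) ?_
    refine (ContinuousLinearMap.opNorm_mulLeftRight_apply_apply_le ℂ _ _ _).trans ?_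
    exact mul_le_one₀ (hU i) (norm_nonneg _) (hV i)
  obtain ⟨Ψ, hΨ⟩ := hs
  exact ⟨Ψ, fun b => hΨ.mapL (ContinuousLinearMap.apply ℂ ℂ b)⟩

/-- Positivity, unitality and stationarity of a functional can be checked on the `λ_g`. -/
theorem isStationaryState_of_coefficients {Γ : Type u} [Group Γ] (μ : PMF Γ) (t : Γ → ℂ)
    (φ : StrongDual ℂ (EllTwo Γ →L[ℂ] EllTwo Γ)) (hφ : ∀ g, φ (leftRegular g) = t g)
    (h1 : t 1 = 1)
    (hpos : ∀ c : Γ →₀ ℂ,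
      0 ≤ ∑ g ∈ c.support, ∑ h ∈ c.support, (star (c g) * c h) * t (g⁻¹ * h))
    (hstat : ∀ h, HasSum (fun g : Γ => (((μ g).toReal : ℝ) : ℂ) * t (g⁻¹ * h * g)) (t h)) :
    IsReducedState (φ.toLinearMap ∘ₗ (reducedCStar Γ).subtype.toAlgHom.toLinearMap) ∧
      IsStationaryFunctional μ
        (φ.toLinearMap ∘ₗ (reducedCStar Γ).subtype.toAlgHom.toLinearMap) := by
  refine ⟨⟨fun a => ?_, ?_⟩, fun a => ?_⟩
  · have hcl : IsClosed {b : EllTwo Γ →L[ℂ] EllTwo Γ | 0 ≤ φ (star b * b)} :=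
      isClosed_le continuous_const (by fun_prop)
    refine hcl.closure_subset_iff.2 ?_ (mem_closure_range_regularCombination a)
    rintro _ ⟨c, rfl⟩
    have := hpos c
    simpa [star_regularCombination_mul_self, hφ] using this
  · change φ 1 = 1
    rw [← leftRegular_one, hφ, h1]
  · obtain ⟨Ψ, hev⟩ := exists_hasSum_conj (fun g : Γ => (μ g).toReal)
      (fun g => ENNReal.toReal_nonneg) (ENNReal.summable_toReal μ.tsum_coe_ne_top)
      (fun g : Γ => leftRegular g⁻¹) (fun g => leftRegular g)
      (fun g => norm_leftRegular_le _) (fun g => norm_leftRegular_le _) φ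
    have hag : ∀ h, Ψ (leftRegular h) = φ (leftRegular h) := fun h => by
      refine (hev (leftRegular h)).unique ?_
      simp only [← leftRegular_mul, hφ]
      exact hstat h
    have heq : Ψ (a : EllTwo Γ →L[ℂ] EllTwo Γ) = φ a := by
      have hcl : IsClosed {b : EllTwo Γ →L[ℂ] EllTwo Γ | Ψ b = φ b} :=
        isClosed_eq Ψ.continuous φ.continuous
      refine hcl.closure_subset_iff.2 ?_ (mem_closure_range_regularCombination a)
      rintro _ ⟨c, rfl⟩
      simp [regularCombination_apply, hag]
    have := hev a
    rw [heq] at this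
    exact this

/-! ### Fixed-point sets and the criterion for essential freeness -/

-- Since `(g⁻¹h)x = x` means `hx = gx`, the matrix is the Gram matrix of the point masses `δ_{gx}`,
-- and the sum is the squared norm of `∑ c_g δ_{gx}`.
open Classical in
theorem sum_sum_fixed_nonneg {Γ : Type u} [Group Γ] {X : Type v} [MulAction Γ X] (S : Finset Γ)
    (c : Γ → ℂ) (x : X) :
    0 ≤ ∑ g ∈ S, ∑ h ∈ S, (star (c g) * c h) * (if (g⁻¹ * h) • x = x then (1 : ℂ) else 0) := by
  let A : Γ → X → ℂ := fun g y => if g • x = y then 1 else 0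
  have h1 : ∀ g ∈ S, ∀ h : Γ, (if (g⁻¹ * h) • x = x then (1 : ℂ) else 0) =
      ∑ y ∈ S.image (· • x), star (A g y) * A h y := by
    intro g hg h
    rw [Finset.sum_eq_single_of_mem (g • x) (Finset.mem_image.2 ⟨g, hg, rfl⟩)
      fun y _ hy => by simp [A, hy.symm]]
    simp [A, mul_smul, inv_smul_eq_iff]
  have h2 : ∑ g ∈ S, ∑ h ∈ S, (star (c g) * c h) * (if (g⁻¹ * h) • x = x then (1 : ℂ) else 0)
      = ∑ y ∈ S.image (· • x), star (∑ g ∈ S, c g * A g y) * ∑ g ∈ S, c g * A g y := by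
    calc _ = ∑ g ∈ S, ∑ h ∈ S, ∑ y ∈ S.image (· • x),
          (star (c g) * c h) * (star (A g y) * A h y) :=
        Finset.sum_congr rfl fun g hg => Finset.sum_congr rfl fun h _ => by
          rw [h1 g hg h, Finset.mul_sum]
      _ = ∑ y ∈ S.image (· • x), ∑ g ∈ S, ∑ h ∈ S,
          (star (c g) * c h) * (star (A g y) * A h y) := by
        simp_rw [Finset.sum_comm (t := S.image (· • x))]
      _ = _ := by
        refine Finset.sum_congr rfl fun y _ => ?_
        rw [star_sum, Finset.sum_mul_sum]
        refine Finset.sum_congr rfl fun g _ => Finset.sum_congr rfl fun h _ => ?_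
        rw [star_mul']
        ring
  rw [h2]
  exact Finset.sum_nonneg fun y _ => star_mul_self_nonneg _

open Classical in
theorem integral_ite_fixed (Γ : Type u) [Group Γ] {X : Type v} [MeasurableSpace X] [MulAction Γ X]
    (ν : Measure X) [IsProbabilityMeasure ν] (hm : HasMeasurableStabilizers Γ ν) (g : Γ) :
    Integrable (fun x => if g • x = x then (1 : ℂ) else 0) ν ∧
      ∫ x, (if g • x = x then (1 : ℂ) else 0) ∂ν = (ν.real {x | g • x = x} : ℂ) := by
  have h : (fun x => if g • x = x then (1 : ℂ) else 0) =
    Set.indicator {x : X | g • x = x} (fun _ => (1 : ℂ)) := rfl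
  rw [h]
  refine ⟨(integrable_const _).indicator₀ (hm g), ?_⟩
  rw [integral_indicator₀ (hm g), setIntegral_const]
  simp

/-- The fixed-point function `g ↦ ν(Fix g)` of a stationary action whose stabilizers are amenable
(in terms of almost invariant vectors) defines a stationary state on `C*_λ(Γ)`. -/
theorem isEssentiallyFree_of_almostInvariantVectors {Γ : Type u} [Group Γ] [Countable Γ]
    (μ : PMF Γ) (hμ : IsCStarSimpleMeasure μ) {X : Type v} [MeasurableSpace X] [MulAction Γ X]
    [MeasurableConstSMul Γ X] (ν : Measure X) [IsProbabilityMeasure ν]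
    (hν : IsStationaryAction μ ν) (hm : HasMeasurableStabilizers Γ ν)
    (hF : ∀ᵐ x ∂ν, ∀ F : Finset Γ, (∀ g ∈ F, g • x = x) → HasAlmostInvariantVectors F) :
    IsEssentiallyFree Γ ν := by
  classical
  let t : Γ → ℂ := fun g => (ν.real {x | g • x = x} : ℂ)
  have hint := fun g => integral_ite_fixed Γ ν hm g
  have ht : ∀ c : Γ →₀ ℂ, ‖∑ g ∈ c.support, c g * t g‖ ≤ ‖regularCombination Γ c‖ := by
    intro c
    have h1 : ∑ g ∈ c.support, c g * t g =
        ∫ x, ∑ g ∈ c.support, c g * (if g • x = x then (1 : ℂ) else 0) ∂ν := by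
      rw [integral_finsetSum _ fun g _ => (hint g).1.const_mul _]
      simp only [integral_const_mul, (hint _).2, t]
    rw [h1]
    refine (norm_integral_le_of_norm_le_const (C := ‖regularCombination Γ c‖) ?_).trans (by simp)
    filter_upwards [hF] with x hx
    exact norm_sum_subgroup_le (MulAction.stabilizer Γ x) hx c.support c
  obtain ⟨φ, hφ⟩ := exists_functional_of_bound t ht
  have hpos : ∀ c : Γ →₀ ℂ,
      0 ≤ ∑ g ∈ c.support, ∑ h ∈ c.support, (star (c g) * c h) * t (g⁻¹ * h) := by
    intro c
    have h1 : ∑ g ∈ c.support, ∑ h ∈ c.support, (star (c g) * c h) * t (g⁻¹ * h) =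
        ∫ x, ∑ g ∈ c.support, ∑ h ∈ c.support,
          (star (c g) * c h) * (if (g⁻¹ * h) • x = x then (1 : ℂ) else 0) ∂ν := by
      rw [integral_finsetSum _ fun g _ => integrable_finsetSum _
        fun h _ => (hint _).1.const_mul _]
      refine Finset.sum_congr rfl fun g _ => ?_
      rw [integral_finsetSum _ fun h _ => (hint _).1.const_mul _]
      simp only [integral_const_mul, (hint _).2, t]
    rw [h1]
    exact integral_nonneg fun x => sum_sum_fixed_nonneg _ _ _
  have hstat : ∀ h, HasSum (fun g : Γ => (((μ g).toReal : ℝ) : ℂ) * t (g⁻¹ * h * g)) (t h) := by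
    intro h
    -- Stationarity of `ν` is evaluated on `Fix h`, whose preimage under `g` is `Fix (g⁻¹hg)`. This
    -- set is only null measurable, and non-singularity transfers that to `gν`.
    have h1 : ∑' g, μ g * ν {x | (g⁻¹ * h * g) • x = x} = ν {x | h • x = x} := by
      conv_rhs => rw [← hν.stationary, Measure.sum_apply₀ _ (by rw [hν.stationary]; exact hm h)]
      refine tsum_congr fun g => ?_
      rw [Measure.smul_apply, smul_eq_mul, Measure.map_apply₀
        (measurable_const_smul g).aemeasurable ((hm h).mono_ac (hν.map_ac g))]
      congr 2
      ext x
      simp [mul_smul, inv_smul_eq_iff]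
    have h2 : HasSum (fun g => (μ g * ν {x | (g⁻¹ * h * g) • x = x}).toReal)
        (ν {x | h • x = x}).toReal := by
      rw [← h1, ENNReal.tsum_toReal_eq fun g =>
        ENNReal.mul_ne_top (μ.apply_ne_top g) (measure_ne_top _ _)]
      exact ENNReal.hasSum_toReal (by rw [h1]; exact measure_ne_top _ _)
    have h3 := (Complex.hasSum_ofReal).2 h2
    simp only [ENNReal.toReal_mul, Complex.ofReal_mul] at h3
    exact h3
  have h1 : t 1 = 1 := by simp [t]
  have hτ := (hμ _).1 (isStationaryState_of_coefficients μ t φ hφ h1 hpos hstat)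
  have hnull : ∀ g : Γ, g ≠ 1 → ∀ᵐ x ∂ν, g • x ≠ x := by
    intro g hg
    have h2 := LinearMap.congr_fun hτ (reducedCStar.of g)
    have h3 : φ (leftRegular g) = leftRegular g (lp.single 2 (1 : Γ) (1 : ℂ)) (1 : Γ) :=
      h2
    rw [hφ, leftRegular_apply_single, if_neg hg.symm] at h3
    have h4 : ν.real {x | g • x = x} = 0 := Complex.ofReal_eq_zero.1 h3
    rw [measureReal_eq_zero_iff] at h4
    exact measure_eq_zero_iff_ae_notMem.1 h4
  have hall : ∀ᵐ x ∂ν, ∀ g : Γ, g ≠ 1 → g • x ≠ x :=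
    ae_all_iff.2 fun g => by
      by_cases hg : g = 1
      · simp [hg]
      · filter_upwards [hnull g hg] with x hx _ using hx
  filter_upwards [hall] with x hx
  rw [eq_bot_iff]
  intro g hg
  by_contra h
  exact hx g h hg

theorem ae_hasAlmostInvariantVectors {Γ : Type u} [Group Γ] [Countable Γ] {X : Type v}
    [MeasurableSpace X] [MulAction Γ X] (ν : Measure X)
    (h : ∀ F : Finset Γ, HasNonamenabilityWitness F → ∀ᵐ x ∂ν, ¬ ∀ g ∈ F, g • x = x) :
    ∀ᵐ x ∂ν, ∀ F : Finset Γ, (∀ g ∈ F, g • x = x) → HasAlmostInvariantVectors F := by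
  refine ae_all_iff.2 fun F => ?_
  by_cases hF : HasAlmostInvariantVectors F
  · exact Eventually.of_forall fun _ _ => hF
  · filter_upwards [h F (hasNonamenabilityWitness_of_not F hF)] with x hx hx'
    exact absurd hx' hx

/-! ### Amenable stabilizers -/

/-- An invariant mean gives `f_g(g ·)` and `f_g`, restricted to `H`, the same value, so it would
send a function bounded below by `δ` to `0`. -/
theorem HasNonamenabilityWitness.not_amenable {Γ : Type u} [Group Γ] {F : Finset Γ}
    (hF : HasNonamenabilityWitness F) (H : Subgroup Γ) (hFH : ∀ g ∈ F, g ∈ H) :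
    ¬ IsAmenableGroup H := by
  rintro ⟨m, h1, hpos, hinv⟩
  obtain ⟨f, C, δ, hC, hδ, hf⟩ := hF
  have hbdd : ∀ (g : F) (k : Γ), Memℓp (fun h : H => f g (k * h)) ∞ := fun g k =>
    memℓp_infty ⟨C, by rintro _ ⟨h, rfl⟩; exact hC g _⟩
  let a : F → lp (fun _ : H => ℝ) ∞ := fun g => ⟨fun h => f g (1 * h), hbdd g 1⟩
  let b : F → lp (fun _ : H => ℝ) ∞ := fun g => ⟨fun h => f g (g * h), hbdd g g⟩
  have hab : ∀ g : F, m (b g) = m (a g) := fun g =>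
    hinv (⟨g, hFH g g.2⟩⁻¹) (a g) (b g) fun h => by simp [a, b]
  have h2 := hpos (∑ g, (b g - a g) - δ • 1) fun h => by
    have := hf h
    simp only [lp.coeFn_sub, lp.coeFn_sum, lp.coeFn_smul, Pi.sub_apply, Finset.sum_apply,
      Pi.smul_apply, lp.infty_coeFn_one, Pi.one_apply, smul_eq_mul, mul_one, a, b, one_mul]
    linarith
  simp only [map_sub, map_sum, map_smul, h1, hab, sub_self, Finset.sum_const_zero, smul_eq_mul,
    mul_one] at h2
  linarith

theorem ae_not_fixed_of_amenableStabilizers {Γ : Type u} [Group Γ] {X : Type v}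
    [MeasurableSpace X] [MulAction Γ X] (ν : Measure X) (h : HasAmenableStabilizers Γ ν)
    (F : Finset Γ) (hF : HasNonamenabilityWitness F) : ∀ᵐ x ∂ν, ¬ ∀ g ∈ F, g • x = x := by
  filter_upwards [h] with x hx hfix
  exact hF.not_amenable (MulAction.stabilizer Γ x) hfix hx

/-! ### Zimmer-amenable actions -/

/-- A bounded function on `Γ`, as an element of `L^∞(Γ × X)`. -/
noncomputable def LInftyProd.ofFun {Γ : Type u} {X : Type v} [MeasurableSpace X] (ν : Measure X) [SFinite ν]
    (f : Γ → ℝ) (C : ℝ) (hf : ∀ g, |f g| ≤ C) : LInftyProd Γ ν :=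
  letI : MeasurableSpace Γ := ⊤
  MemLp.toLp (fun p : Γ × X => f p.1) (memLp_top_of_bound
    (measurable_from_top.comp measurable_fst).aestronglyMeasurable C
    (Eventually.of_forall fun p => hf p.1))

theorem LInftyProd.coeFn_ofFun {Γ : Type u} {X : Type v} [MeasurableSpace X] (ν : Measure X)
    [SFinite ν] (f : Γ → ℝ) (C : ℝ) (hf : ∀ g, |f g| ≤ C) :
    ∀ᵐ p ∂(countProd Γ ν), LInftyProd.ofFun ν f C hf p = f p.1 :=
  letI : MeasurableSpace Γ := ⊤
  MemLp.coeFn_toLp _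

theorem ae_countProd_smul {Γ : Type u} [Group Γ] [Countable Γ] {X : Type v} [MeasurableSpace X]
    [MulAction Γ X] [MeasurableConstSMul Γ X] {ν : Measure X} [SFinite ν] {g : Γ}
    (hν : ν.map (fun x => g • x) ≪ ν) {p : Γ × X → Prop} (hp : ∀ᵐ q ∂(countProd Γ ν), p q) :
    ∀ᵐ q ∂(countProd Γ ν), p (g * q.1, g • q.2) := by
  let _ : MeasurableSpace Γ := ⊤
  have hg : Measurable (fun h : Γ => g * h) := measurable_from_top
  have h1 : Measure.count.map (fun h : Γ => g * h) ≪ Measure.count :=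
    Measure.AbsolutelyContinuous.mk fun s _ hs => by
      rw [Measure.count_eq_zero_iff] at hs
      simp [hs]
  have h2 : Measure.QuasiMeasurePreserving (Prod.map (fun h : Γ => g * h) (fun x : X => g • x))
      (countProd Γ ν) (countProd Γ ν) := by
    refine ⟨hg.prodMap (measurable_const_smul g), ?_⟩
    rw [countProd, ← Measure.map_prod_map _ _ hg (measurable_const_smul g)]
    exact h1.prod hν
  exact h2.ae hp

/-- Regard the `f_g` as functions on `Γ × X` constant in `x`. Equivariance gives `P(f_g(g ·))(x) =
P(f_g)(gx)`, which is `P(f_g)(x)` when `gx = x`, while positivity bounds the sum of the differences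
below by `δ`. -/
theorem ae_not_fixed_of_zimmerAmenable {Γ : Type u} [Group Γ] [Countable Γ] {X : Type v}
    [MeasurableSpace X] [MulAction Γ X] [MeasurableConstSMul Γ X] (ν : Measure X) [SFinite ν]
    (hν : ∀ g : Γ, ν.map (fun x => g • x) ≪ ν) (h : IsZimmerAmenable Γ ν)
    (F : Finset Γ) (hF : HasNonamenabilityWitness F) : ∀ᵐ x ∂ν, ¬ ∀ g ∈ F, g • x = x := by
  obtain ⟨f, C, δ, hC, hδ, hf⟩ := hF
  obtain ⟨P, hone, hpos, -, hequiv⟩ := h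
  let a : F → LInftyProd Γ ν := fun g => LInftyProd.ofFun ν (f g) C (hC g)
  let b : F → LInftyProd Γ ν := fun g =>
    LInftyProd.ofFun ν (fun h => f g (g * h)) C (fun h => hC g _)
  let e : LInftyProd Γ ν := LInftyProd.ofFun ν (fun _ => (1 : ℝ)) 1 (by simp)
  have ha : ∀ g, ∀ᵐ p ∂(countProd Γ ν), a g p = f g p.1 := fun g => LInftyProd.coeFn_ofFun _ _ _ _
  have hb : ∀ g : F, ∀ᵐ p ∂(countProd Γ ν), b g p = f g (g * p.1) :=
    fun g => LInftyProd.coeFn_ofFun ν (fun h => f g (g * h)) C (fun h => hC g _)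
  have he : ∀ᵐ p ∂(countProd Γ ν), e p = 1 := LInftyProd.coeFn_ofFun ν (fun _ => (1 : ℝ)) 1 _
  have hPab : ∀ g : F, ∀ᵐ x ∂ν, P (b g) x = P (a g) ((g : Γ) • x) := fun g => by
    have := hequiv (g : Γ)⁻¹ (a g) (b g) (by
      have h1 := ae_countProd_smul (hν g) (ha g)
      filter_upwards [h1, hb g] with p hp hp'
      simpa [hp'] using hp.symm)
    simpa using this
  have hP1 := hone e he
  have hk : ∀ᵐ x ∂ν, 0 ≤ P (∑ g, (b g - a g) - δ • e) x := by
    refine hpos _ ?_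
    let _ : MeasurableSpace Γ := ⊤
    filter_upwards [Lp.coeFn_sub (∑ g, (b g - a g)) (δ • e), Lp.coeFn_smul δ e,
      Lp.coeFn_fun_finsetSum Finset.univ (fun g => b g - a g),
      ae_all_iff.2 fun g => Lp.coeFn_sub (b g) (a g), ae_all_iff.2 ha, ae_all_iff.2 hb, he]
      with p h1 h2 h3 h4 h5 h6 h7
    rw [h1, Pi.sub_apply, h2, h3, Pi.smul_apply, h7]
    have := hf p.1
    simp only [h4, h5, h6, Pi.sub_apply, smul_eq_mul, mul_one]
    linarith
  have hsplit : P (∑ g, (b g - a g) - δ • e) = ∑ g, (P (b g) - P (a g)) - δ • P e := by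
    simp
  rw [hsplit] at hk
  filter_upwards [hk, Lp.coeFn_sub (∑ g, (P (b g) - P (a g))) (δ • P e), Lp.coeFn_smul δ (P e),
      Lp.coeFn_fun_finsetSum Finset.univ (fun g => P (b g) - P (a g)),
      ae_all_iff.2 fun g => Lp.coeFn_sub (P (b g)) (P (a g)), ae_all_iff.2 hPab, hP1]
      with x h0 h1 h2 h3 h4 h5 h6 hfix
  rw [h1, Pi.sub_apply, h2, h3, Pi.smul_apply, h6] at h0
  have hz : ∀ g : F, (P (b g) - P (a g) : Lp ℝ ∞ ν) x = 0 := fun g => by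
    rw [h4, Pi.sub_apply, h5, hfix g g.2, sub_self]
  simp only [hz, Finset.sum_const_zero, smul_eq_mul, mul_one] at h0
  linarith

/-! ### Averaging over the random walk -/

/-- The Markov operator `(Pf)(h) = ∑_g μ(g) f(hg)` of the right random walk. -/
noncomputable def markovOperator {Γ : Type u} [Group Γ] (μ : PMF Γ) (f : Γ → ℝ) (h : Γ) : ℝ :=
  ∑' g, (μ g).toReal * f (h * g)

theorem PMF.hasSum_toReal {Γ : Type u} (μ : PMF Γ) : HasSum (fun g => (μ g).toReal) 1 := by
  have := ENNReal.hasSum_toReal μ.tsum_coe_ne_top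
  rwa [← ENNReal.tsum_toReal_eq μ.apply_ne_top, μ.tsum_coe, ENNReal.toReal_one] at this

theorem norm_weight_mul_le {Γ : Type u} (μ : PMF Γ) {f : Γ → ℝ} {C : ℝ} (hf : ∀ g, |f g| ≤ C)
    (g k : Γ) : ‖(μ g).toReal * f k‖ ≤ (μ g).toReal * C := by
  rw [norm_mul, Real.norm_of_nonneg ENNReal.toReal_nonneg]
  exact mul_le_mul_of_nonneg_left (hf k) ENNReal.toReal_nonneg

theorem hasSum_markovOperator {Γ : Type u} [Group Γ] (μ : PMF Γ) {f : Γ → ℝ} {C : ℝ}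
    (hf : ∀ g, |f g| ≤ C) (h : Γ) :
    HasSum (fun g => (μ g).toReal * f (h * g)) (markovOperator μ f h) :=
  (Summable.of_norm_bounded (μ.hasSum_toReal.summable.mul_right C)
    fun g => norm_weight_mul_le μ hf g (h * g)).hasSum

theorem abs_markovOperator_le {Γ : Type u} [Group Γ] (μ : PMF Γ) {f : Γ → ℝ} {C : ℝ}
    (hf : ∀ g, |f g| ≤ C) (h : Γ) : |markovOperator μ f h| ≤ C := by
  have := tsum_of_norm_bounded (μ.hasSum_toReal.mul_right C)
    fun g => norm_weight_mul_le μ hf g (h * g)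
  rwa [one_mul] at this

theorem abs_iterate_markovOperator_le {Γ : Type u} [Group Γ] (μ : PMF Γ) {f : Γ → ℝ} {C : ℝ}
    (hf : ∀ g, |f g| ≤ C) (n : ℕ) (h : Γ) : |(markovOperator μ)^[n] f h| ≤ C := by
  induction n generalizing h with
  | zero => exact hf h
  | succ n ih =>
    rw [Function.iterate_succ_apply']
    exact abs_markovOperator_le μ ih h

/-- The Markov operator averages right translates and the witness inequality compares left
translates; the two commute. -/
theorem markovOperator_witness {Γ : Type u} [Group Γ] (μ : PMF Γ) {F : Finset Γ}
    {f : F → Γ → ℝ} {C δ : ℝ} (hC : ∀ g h, |f g h| ≤ C)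
    (hf : ∀ h : Γ, δ ≤ ∑ g : F, (f g (g * h) - f g h)) (h : Γ) :
    δ ≤ ∑ g : F, (markovOperator μ (f g) (g * h) - markovOperator μ (f g) h) := by
  have h1 := hasSum_sum (s := Finset.univ) fun (g : F) _ =>
    (hasSum_markovOperator μ (hC g) (g * h)).sub (hasSum_markovOperator μ (hC g) h)
  have h2 := μ.hasSum_toReal.mul_right δ
  rw [one_mul] at h2
  refine hasSum_le (fun s => ?_) h2 h1
  simp only [← mul_sub, ← Finset.mul_sum, mul_assoc]
  exact mul_le_mul_of_nonneg_left (hf (h * s)) ENNReal.toReal_nonneg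

theorem iterate_markovOperator_witness {Γ : Type u} [Group Γ] (μ : PMF Γ) {F : Finset Γ}
    {f : F → Γ → ℝ} {C δ : ℝ} (hC : ∀ g h, |f g h| ≤ C)
    (hf : ∀ h : Γ, δ ≤ ∑ g : F, (f g (g * h) - f g h)) (n : ℕ) (h : Γ) :
    δ ≤ ∑ g : F, ((markovOperator μ)^[n] (f g) (g * h) - (markovOperator μ)^[n] (f g) h) := by
  induction n generalizing h with
  | zero => exact hf h
  | succ n ih =>
    simp only [Function.iterate_succ_apply']
    exact markovOperator_witness μ
      (fun g k => abs_iterate_markovOperator_le μ (hC g) n k) ih h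

/-- The Cesàro means of the iterates of the Markov operator. -/
noncomputable def cesaroMean {Γ : Type u} [Group Γ] (μ : PMF Γ) (f : Γ → ℝ) (n : ℕ) (h : Γ) : ℝ :=
  ((n : ℝ) + 1)⁻¹ * ∑ k ∈ Finset.range (n + 1), (markovOperator μ)^[k] f h

theorem abs_cesaroMean_le {Γ : Type u} [Group Γ] (μ : PMF Γ) {f : Γ → ℝ} {C : ℝ}
    (hf : ∀ g, |f g| ≤ C) (n : ℕ) (h : Γ) : |cesaroMean μ f n h| ≤ C := by
  have hn : (0 : ℝ) < (n : ℝ) + 1 := by positivity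
  rw [cesaroMean, abs_mul, abs_of_pos (inv_pos.2 hn), inv_mul_le_iff₀ hn]
  refine (Finset.abs_sum_le_sum_abs _ _).trans ?_
  refine (Finset.sum_le_card_nsmul _ _ C
    fun k _ => abs_iterate_markovOperator_le μ hf k h).trans_eq ?_
  simp

/-- Telescoping: Cesàro means are harmonic up to an error of order `1/n`. -/
theorem markovOperator_cesaroMean {Γ : Type u} [Group Γ] (μ : PMF Γ) {f : Γ → ℝ} {C : ℝ}
    (hf : ∀ g, |f g| ≤ C) (n : ℕ) (h : Γ) :
    markovOperator μ (cesaroMean μ f n) h =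
      cesaroMean μ f n h + ((n : ℝ) + 1)⁻¹ * ((markovOperator μ)^[n + 1] f h - f h) := by
  have h1 := (hasSum_sum (s := Finset.range (n + 1)) fun k _ =>
    hasSum_markovOperator μ (fun g => abs_iterate_markovOperator_le μ hf k g) h).mul_left
      ((n : ℝ) + 1)⁻¹
  have h2 := hasSum_markovOperator μ (fun g => abs_cesaroMean_le μ hf n g) h
  have h3 : markovOperator μ (cesaroMean μ f n) h = ((n : ℝ) + 1)⁻¹ *
      ∑ k ∈ Finset.range (n + 1), markovOperator μ ((markovOperator μ)^[k] f) h := by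
    have h4 : (fun g => (μ g).toReal * cesaroMean μ f n (h * g)) = fun g => ((n : ℝ) + 1)⁻¹ *
        ∑ k ∈ Finset.range (n + 1), (μ g).toReal * (markovOperator μ)^[k] f (h * g) := by
      funext g
      rw [cesaroMean, ← Finset.mul_sum]
      ring
    rw [h4] at h2
    exact h2.unique h1
  rw [h3, cesaroMean, ← mul_add]
  congr 1
  simp only [← Function.iterate_succ_apply' (markovOperator μ)]
  have := Finset.sum_range_sub (fun k => (markovOperator μ)^[k] f h) (n + 1)
  rw [Finset.sum_sub_distrib] at this
  simp only [Function.iterate_zero, id] at this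
  linarith

/-- A nonamenability witness can be replaced by one that consists of harmonic functions. -/
theorem HasNonamenabilityWitness.exists_harmonic {Γ : Type u} [Group Γ] (μ : PMF Γ)
    {F : Finset Γ} (hF : HasNonamenabilityWitness F) :
    ∃ (f : F → Γ → ℝ) (C δ : ℝ), (∀ g h, |f g h| ≤ C) ∧ 0 < δ ∧
      (∀ h : Γ, δ ≤ ∑ g : F, (f g (g * h) - f g h)) ∧ ∀ g h, markovOperator μ (f g) h = f g h := by
  obtain ⟨f, C, δ, hC, hδ, hf⟩ := hF
  -- A limit along one free ultrafilter exists at every point simultaneously. Dominated convergence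
  -- passes the Markov operator through it, so the limits are harmonic.
  let U : Ultrafilter ℕ := hyperfilter ℕ
  have hU : (U : Filter ℕ) ≤ atTop := by
    rw [← Nat.cofinite_eq_atTop]
    exact hyperfilter_le_cofinite
  have hlim : ∀ (g : F) (h : Γ), ∃ y ∈ Set.Icc (-C) C,
      Tendsto (fun n => cesaroMean μ (f g) n h) U (𝓝 y) := by
    intro g h
    obtain ⟨y, hy, hy'⟩ := isCompact_Icc.ultrafilter_le_nhds
      (U.map (fun n => cesaroMean μ (f g) n h)) (s := Set.Icc (-C) C)
      (by
        rw [le_principal_iff]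
        exact Filter.Eventually.of_forall (f := U) fun n =>
          abs_le.1 (abs_cesaroMean_le μ (hC g) n h))
    exact ⟨y, hy, hy'⟩
  choose y hy hlim using hlim
  refine ⟨y, C, δ, fun g h => abs_le.2 (hy g h), hδ, fun h => ?_, fun g h => ?_⟩
  · refine ge_of_tendsto (tendsto_finsetSum (Finset.univ : Finset F) fun g _ =>
      (hlim g (g * h)).sub (hlim g h)) (Eventually.of_forall fun n => ?_)
    have hn : (0 : ℝ) < (n : ℝ) + 1 := by positivity
    simp only [cesaroMean, ← mul_sub, ← Finset.sum_sub_distrib, ← Finset.mul_sum]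
    rw [Finset.sum_comm, le_inv_mul_iff₀ hn]
    have := Finset.card_nsmul_le_sum (Finset.range (n + 1)) _ δ
      fun k _ => iterate_markovOperator_witness μ hC hf k h
    simpa using this
  · have h1 : Tendsto (fun n => markovOperator μ (cesaroMean μ (f g) n) h) U
        (𝓝 (markovOperator μ (y g) h)) := by
      refine tendsto_tsum_of_dominated_convergence
        (μ.hasSum_toReal.summable.mul_right C) (fun s => (hlim g (h * s)).const_mul _)
        (Eventually.of_forall fun n s =>
          norm_weight_mul_le μ (fun k => abs_cesaroMean_le μ (hC g) n k) s (h * s))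
    have h2 : Tendsto (fun n : ℕ => ((n : ℝ) + 1)⁻¹ *
        ((markovOperator μ)^[n + 1] (f g) h - f g h)) atTop (𝓝 0) := by
      have h3 : Tendsto (fun n : ℕ => ((n : ℝ) + 1)⁻¹) atTop (𝓝 0) := by
        simpa using tendsto_one_div_add_atTop_nhds_zero_nat (𝕜 := ℝ)
      refine h3.zero_mul_isBoundedUnder_le ⟨C + C, ?_⟩
      refine eventually_map.2 (Eventually.of_forall fun n => ?_)
      refine (norm_sub_le _ _).trans ?_
      exact add_le_add (abs_iterate_markovOperator_le μ (hC g) _ h) (hC g h)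
    refine tendsto_nhds_unique h1 ?_
    simp only [markovOperator_cesaroMean μ (hC g)]
    simpa using (hlim g h).add (h2.mono_left hU)

/-! ### The random walk -/

/-- The increments after time `n`. -/
def futureIncrements {Γ : Type u} (n : ℕ) (s : ℕ → Γ) : ℕ → Γ := fun i => s (n + i)

theorem walkPosition_add {Γ : Type u} [Group Γ] (s : ℕ → Γ) (n m : ℕ) :
    walkPosition s (n + m) = walkPosition s n * walkPosition (futureIncrements n s) m := by
  induction m with
  | zero => simp [walkPosition]
  | succ m ih =>
    rw [← add_assoc, walkPosition, ih, walkPosition, mul_assoc]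
    rfl

section Walk

variable {Γ : Type u} [MeasurableSpace Γ]

/-- The law of the increments, for a discrete measurable structure on `Γ`. -/
noncomputable abbrev incrementMeasure (μ : PMF Γ) : Measure (ℕ → Γ) :=
  Measure.infinitePi (fun _ : ℕ => μ.toMeasure)

theorem measurePreserving_futureIncrements (μ : PMF Γ) (n : ℕ) :
    MeasurePreserving (futureIncrements n) (incrementMeasure μ) (incrementMeasure μ) :=
  ⟨measurable_pi_lambda _ fun _ => measurable_pi_apply _,
    Measure.map_infinitePi_infinitePi_of_inj (P := fun _ : ℕ => μ.toMeasure)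
      (f := fun i => n + i) (add_right_injective n)⟩

/-- The filtration generated by the increments. -/
def incrementFiltration (Γ : Type u) [MeasurableSpace Γ] :
    Filtration ℕ (MeasurableSpace.pi : MeasurableSpace (ℕ → Γ)) where
  seq n := ⨆ i ∈ Set.Iio n, MeasurableSpace.comap (fun s : ℕ → Γ => s i) inferInstance
  mono' _ _ hnm := biSup_mono fun _ hi => lt_of_lt_of_le hi hnm
  le' _ := iSup₂_le fun i _ => (measurable_pi_apply i).comap_le

theorem iSup_incrementFiltration :
    (⨆ n, incrementFiltration Γ n : MeasurableSpace (ℕ → Γ)) = MeasurableSpace.pi := by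
  refine le_antisymm (iSup_le fun n => (incrementFiltration Γ).le n) (iSup_le fun i => ?_)
  refine le_trans ?_ (le_iSup _ (i + 1))
  exact le_iSup₂ (f := fun (j : ℕ) (_ : j ∈ Set.Iio (i + 1)) =>
    MeasurableSpace.comap (fun s : ℕ → Γ => s j) inferInstance) i (Nat.lt_succ_self i)

theorem measurable_increment {i n : ℕ} (hin : i < n) :
    Measurable[incrementFiltration Γ n] (fun s : ℕ → Γ => s i) := by
  rw [measurable_iff_comap_le]
  exact le_iSup₂ (f := fun (j : ℕ) (_ : j ∈ Set.Iio n) =>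
    MeasurableSpace.comap (fun s : ℕ → Γ => s j) inferInstance) i hin

theorem indep_future_past (μ : PMF Γ) (n : ℕ) :
    ProbabilityTheory.Indep (MeasurableSpace.comap (futureIncrements n) MeasurableSpace.pi)
      (incrementFiltration Γ n) (incrementMeasure μ) := by
  have h1 : ProbabilityTheory.iIndep
      (fun i => MeasurableSpace.comap (fun s : ℕ → Γ => s i) inferInstance)
      (incrementMeasure μ) :=
    (ProbabilityTheory.iIndepFun_infinitePi (P := fun _ : ℕ => μ.toMeasure)
      (X := fun _ g => g) fun _ => measurable_id).iIndep
  have h2 := ProbabilityTheory.indep_iSup_of_disjoint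
    (fun i => (measurable_pi_apply i).comap_le) h1 (S := Set.Ici n) (T := Set.Iio n)
    (Set.disjoint_left.2 fun i (hi : n ≤ i) (hi' : i < n) => absurd hi' hi.not_gt)
  refine ProbabilityTheory.indep_of_indep_of_le_left h2 ?_
  rw [← measurable_iff_comap_le]
  refine @measurable_pi_lambda _ _ _ (_) _ _ fun i => ?_
  rw [measurable_iff_comap_le]
  exact le_iSup₂ (f := fun (j : ℕ) (_ : j ∈ Set.Ici n) =>
    MeasurableSpace.comap (fun s : ℕ → Γ => s j) inferInstance) (n + i) (Nat.le_add_right n i)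

variable [Group Γ] [Countable Γ] [DiscreteMeasurableSpace Γ]

theorem measurable_walkPosition_of_le {m n : ℕ} (hmn : m ≤ n) :
    Measurable[incrementFiltration Γ n] (fun s : ℕ → Γ => walkPosition s m) := by
  induction m with
  | zero => exact @measurable_const _ _ _ (incrementFiltration Γ n) _
  | succ m ih =>
    have h1 : Measurable (fun p : Γ × Γ => p.1 * p.2) := measurable_of_countable _
    have h2 : Measurable[incrementFiltration Γ n]
        (fun s : ℕ → Γ => (walkPosition s m, s m)) :=
      (ih (by omega)).prodMk (measurable_increment hmn)
    exact h1.comp h2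

theorem measurable_walkPosition (n : ℕ) : Measurable (fun s : ℕ → Γ => walkPosition s n) :=
  (measurable_walkPosition_of_le le_rfl).mono ((incrementFiltration Γ).le n) le_rfl

theorem integrable_markov (μ : PMF Γ) {G : Γ → (ℕ → Γ) → ℝ} (hG : ∀ g, Measurable (G g))
    {C : ℝ} (hC : ∀ g s, |G g s| ≤ C) (n : ℕ) :
    Integrable (fun s => G (walkPosition s n) (futureIncrements n s)) (incrementMeasure μ) := by
  refine Integrable.of_bound (C := C) ?_ (Eventually.of_forall fun s => hC _ _)
  have h1 : Measurable (fun p : Γ × (ℕ → Γ) => G p.1 p.2) := measurable_from_prod_countable_right hG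
  exact (h1.comp ((measurable_walkPosition n).prodMk
    (measurePreserving_futureIncrements μ n).measurable)).aestronglyMeasurable

/-- The Markov property of the random walk. -/
theorem condExp_markov (μ : PMF Γ) {G : Γ → (ℕ → Γ) → ℝ} (hG : ∀ g, Measurable (G g))
    {C : ℝ} (hC : ∀ g s, |G g s| ≤ C) (n : ℕ) :
    (incrementMeasure μ)[fun s => G (walkPosition s n) (futureIncrements n s) |
        incrementFiltration Γ n]
      =ᵐ[incrementMeasure μ] fun s => ∫ s', G (walkPosition s n) s' ∂(incrementMeasure μ) := by
  have hfut := measurePreserving_futureIncrements μ n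
  have key : ∀ g : Γ, ∀ᵐ s ∂(incrementMeasure μ), walkPosition s n = g →
      (incrementMeasure μ)[fun s => G (walkPosition s n) (futureIncrements n s) |
        incrementFiltration Γ n] s = ∫ s', G g s' ∂(incrementMeasure μ) := by
    intro g
    -- On this event, which belongs to the past, the position is the constant `g`, and what remains
    -- depends only on the future increments, which are independent of the past. Countably many such
    -- events cover the path space.
    let A : Set (ℕ → Γ) := {s | walkPosition s n = g}
    have hA : MeasurableSet[incrementFiltration Γ n] A :=
      measurable_walkPosition_of_le le_rfl (measurableSet_singleton g)
    have hint : Integrable (fun s => G g (futureIncrements n s)) (incrementMeasure μ) :=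
      Integrable.of_bound (C := C) ((hG g).comp hfut.measurable).aestronglyMeasurable
        (Eventually.of_forall fun s => hC _ _)
    have h1 := condExp_indicator (integrable_markov μ hG hC n) hA
    have h2 := condExp_indicator hint hA
    have h3 : A.indicator (fun s => G (walkPosition s n) (futureIncrements n s)) =
        A.indicator (fun s => G g (futureIncrements n s)) :=
      Set.indicator_congr fun s hs => by rw [show walkPosition s n = g from hs]
    have h4 : (incrementMeasure μ)[fun s => G g (futureIncrements n s) | incrementFiltration Γ n]
        =ᵐ[incrementMeasure μ] fun _ => ∫ s, G g (futureIncrements n s) ∂(incrementMeasure μ) :=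
      MeasureTheory.condExp_indep_eq hfut.measurable.comap_le ((incrementFiltration Γ).le n)
        (Measurable.stronglyMeasurable
          (@Measurable.comp _ _ _ (_) _ _ _ _ (hG g) (comap_measurable (futureIncrements n))))
        (indep_future_past μ n)
    have h5 : ∫ s, G g (futureIncrements n s) ∂(incrementMeasure μ) =
        ∫ s', G g s' ∂(incrementMeasure μ) := by
      conv_rhs => rw [← hfut.map_eq]
      exact (integral_map hfut.measurable.aemeasurable (hG g).aestronglyMeasurable).symm
    rw [h3] at h1
    filter_upwards [h1, h2, h4] with s k1 k2 k4 hs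
    rw [k2, Set.indicator_of_mem (s := A) hs, Set.indicator_of_mem (s := A) hs, k4, h5] at k1
    exact k1.symm
  filter_upwards [ae_all_iff.2 key] with s hs using hs _ rfl

/-- Bounded harmonic functions converge along almost every path. -/
theorem ae_tendsto_harmonic (μ : PMF Γ) {f : Γ → ℝ} {C : ℝ} (hf : ∀ g, |f g| ≤ C)
    (hh : ∀ g, markovOperator μ f g = f g) (k : Γ) :
    ∀ᵐ s ∂(incrementMeasure μ), ∃ c,
      Tendsto (fun n => f (k * walkPosition s n)) atTop (𝓝 c) := by
  -- Only the next increment is read, so the Markov property with harmonicity says that `f(k ω_n)`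
  -- is a bounded martingale.
  let G : Γ → (ℕ → Γ) → ℝ := fun g s => f (k * (g * s 0))
  have hG : ∀ g, Measurable (G g) := fun g =>
    (Measurable.of_discrete (f := fun h : Γ => f (k * (g * h)))).comp (measurable_pi_apply 0)
  have hmart : Martingale (fun n s => f (k * walkPosition s n)) (incrementFiltration Γ)
      (incrementMeasure μ) := by
    refine martingale_nat (fun n => ?_) (fun n => ?_) fun n => ?_
    · exact Measurable.stronglyMeasurable ((Measurable.of_discrete
        (f := fun h : Γ => f (k * h))).comp (measurable_walkPosition_of_le le_rfl))
    · exact Integrable.of_bound (C := C) ((Measurable.of_discrete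
        (f := fun h : Γ => f (k * h))).comp (measurable_walkPosition n)).aestronglyMeasurable
        (Eventually.of_forall fun s => hf _)
    · have h1 := condExp_markov μ hG (fun g s => hf _) n
      have h2 : (fun s : ℕ → Γ => f (k * walkPosition s (n + 1))) =
          fun s => G (walkPosition s n) (futureIncrements n s) := rfl
      rw [h2]
      refine (h1.trans (Eventually.of_forall fun s => ?_)).symm
      have h3 : ∫ s' : ℕ → Γ, G (walkPosition s n) s' ∂(incrementMeasure μ) =
          ∫ g, f (k * (walkPosition s n * g)) ∂μ.toMeasure := by
        have h4 := measurePreserving_eval_infinitePi (fun _ : ℕ => μ.toMeasure) 0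
        conv_rhs => rw [← h4.map_eq]
        exact (integral_map h4.measurable.aemeasurable (Measurable.of_discrete
          (f := fun g : Γ => f (k * (walkPosition s n * g)))).aestronglyMeasurable).symm
      change ∫ s' : ℕ → Γ, G (walkPosition s n) s' ∂(incrementMeasure μ) = _
      rw [h3, PMF.integral_eq_tsum _ _ (Integrable.of_bound (C := C)
        Measurable.of_discrete.aestronglyMeasurable (Eventually.of_forall fun s => hf _))]
      rw [← hh (k * walkPosition s n)]
      simp only [markovOperator, smul_eq_mul, mul_assoc]
  refine hmart.submartingale.exists_ae_tendsto_of_bdd (R := C.toNNReal) fun n => ?_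
  refine (eLpNorm_le_of_ae_bound (C := C) (Eventually.of_forall fun s => hf _)).trans ?_
  simp [ENNReal.ofReal]

end Walk

/-! ### The boundary of a finite family of harmonic functions -/

/-- The compact `Γ`-space of families of functions on `Γ` with values in `[-C, C]`. -/
def FunctionSpace (ι Γ : Type u) (C : ℝ) : Type u := ι × Γ → Set.Icc (-C) C

namespace FunctionSpace

variable {ι Γ : Type u} {C : ℝ}

instance : TopologicalSpace (FunctionSpace ι Γ C) :=
  inferInstanceAs (TopologicalSpace (ι × Γ → Set.Icc (-C) C))

instance : CompactSpace (FunctionSpace ι Γ C) :=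
  inferInstanceAs (CompactSpace (ι × Γ → Set.Icc (-C) C))

instance : MeasurableSpace (FunctionSpace ι Γ C) :=
  inferInstanceAs (MeasurableSpace (ι × Γ → Set.Icc (-C) C))

instance : T2Space (FunctionSpace ι Γ C) :=
  inferInstanceAs (T2Space (ι × Γ → Set.Icc (-C) C))

instance [Countable ι] [Countable Γ] : SecondCountableTopology (FunctionSpace ι Γ C) :=
  inferInstanceAs (SecondCountableTopology (ι × Γ → Set.Icc (-C) C))

instance [Countable ι] [Countable Γ] : TopologicalSpace.MetrizableSpace (FunctionSpace ι Γ C) :=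
  TopologicalSpace.metrizableSpace_of_t3_secondCountable _

instance [Countable ι] [Countable Γ] : BorelSpace (FunctionSpace ι Γ C) :=
  inferInstanceAs (BorelSpace (ι × Γ → Set.Icc (-C) C))

/-- Right translation of the argument is a left action. It is the one that corresponds to
multiplying a path on the left by `g` when `z(i, k) = lim f_i(k ω_n)`. -/
instance [Group Γ] : MulAction Γ (FunctionSpace ι Γ C) where
  smul g z := fun p => z (p.1, p.2 * g)
  one_smul z := funext fun p => congrArg z (by simp)
  mul_smul g h z := funext fun p => congrArg z (by simp [mul_assoc])

theorem smul_apply [Group Γ] (g : Γ) (z : FunctionSpace ι Γ C) (p : ι × Γ) :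
    (g • z) p = z (p.1, p.2 * g) := rfl

instance [Group Γ] : ContinuousConstSMul Γ (FunctionSpace ι Γ C) where
  continuous_const_smul g :=
    continuous_pi fun p => continuous_apply (A := fun _ : ι × Γ => Set.Icc (-C) C) (p.1, p.2 * g)

end FunctionSpace

/-- The limit of a family of functions along a path of the random walk. -/
noncomputable def boundaryMap {ι Γ : Type u} [Group Γ] (f : ι → Γ → ℝ) {C : ℝ} (hC : -C ≤ C) (s : ℕ → Γ) :
    FunctionSpace ι Γ C := fun p =>
  Set.projIcc (-C) C hC (limsup (fun n => f p.1 (p.2 * walkPosition s n)) atTop)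

/-- A limsup ignores finitely many initial terms. Defining the map by a limsup makes the identity
hold for every path, without an exceptional null set. -/
theorem boundaryMap_eq_smul {ι Γ : Type u} [Group Γ] (f : ι → Γ → ℝ) {C : ℝ} (hC : -C ≤ C)
    (n : ℕ) (s : ℕ → Γ) :
    boundaryMap f hC s = walkPosition s n • boundaryMap f hC (futureIncrements n s) := by
  funext p
  rw [FunctionSpace.smul_apply, boundaryMap, boundaryMap, ← limsup_nat_add _ n]
  simp only [add_comm _ n, walkPosition_add, mul_assoc]

/-- The `g` with `gκ ≪ κ` form a semigroup, which contains the support of `μ` by stationarity, hence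
is `Γ`. Pushing `g⁻¹κ ≪ κ` forward by `g` gives the converse relation. -/
theorem isStationaryAction_of_isGenerating {Γ : Type u} [Group Γ] [Countable Γ] {K : Type v}
    [MeasurableSpace K] [MulAction Γ K] [MeasurableConstSMul Γ K] {μ : PMF Γ}
    (hμ : IsGenerating μ) (κ : Measure K)
    (hκ : Measure.sum (fun g : Γ => μ g • κ.map (fun z => g • z)) = κ) :
    IsStationaryAction μ κ := by
  let S : Subsemigroup Γ :=
    { carrier := {g : Γ | κ.map (fun z => g • z) ≪ κ}
      mul_mem' := fun {g h} hg hh => by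
        have h1 : (fun z : K => (g * h) • z) = (fun z : K => g • z) ∘ fun z : K => h • z := by
          funext z
          exact mul_smul g h z
        change κ.map (fun z : K => (g * h) • z) ≪ κ
        rw [h1, ← Measure.map_map (measurable_const_smul g) (measurable_const_smul h)]
        have hh' : κ.map (fun z => h • z) ≪ κ := hh
        exact (hh'.map (measurable_const_smul g)).trans hg }
  have hS : ∀ g : Γ, κ.map (fun z => g • z) ≪ κ := by
    intro g
    have h1 : Subsemigroup.closure μ.support ≤ S := by
      rw [Subsemigroup.closure_le]
      intro h hh
      refine Measure.AbsolutelyContinuous.mk fun A hA h0 => ?_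
      rw [← hκ, Measure.sum_apply _ hA, ENNReal.tsum_eq_zero] at h0
      have := h0 h
      rw [Measure.smul_apply, smul_eq_mul, mul_eq_zero] at this
      exact this.resolve_left ((PMF.mem_support_iff μ h).1 hh)
    have h2 : g ∈ Subsemigroup.closure μ.support := by
      rw [show Subsemigroup.closure μ.support = ⊤ from hμ]
      trivial
    exact h1 h2
  refine ⟨hS, fun g => ?_, hκ⟩
  have h1 := (hS g⁻¹).map (measurable_const_smul g)
  rw [Measure.map_map (measurable_const_smul g) (measurable_const_smul g⁻¹)] at h1
  have h2 : ((fun z : K => g • z) ∘ fun z => g⁻¹ • z) = id := by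
    funext z
    simp
  rwa [h2, Measure.map_id] at h1

section Walk

variable {ι Γ : Type u} [Group Γ] [Countable Γ] [MeasurableSpace Γ]
  [DiscreteMeasurableSpace Γ]

theorem measurable_boundaryMap (f : ι → Γ → ℝ) {C : ℝ} (hC : -C ≤ C) :
    Measurable (boundaryMap f hC) := by
  refine measurable_pi_lambda _ fun p => continuous_projIcc.measurable.comp ?_
  exact Measurable.limsup fun n =>
    (Measurable.of_discrete (f := fun g : Γ => f p.1 (p.2 * g))).comp (measurable_walkPosition n)

/-- The law of the limit point of the random walk. -/
noncomputable def hittingMeasure (μ : PMF Γ) (f : ι → Γ → ℝ) {C : ℝ} (hC : -C ≤ C) :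
    Measure (FunctionSpace ι Γ C) := (incrementMeasure μ).map (boundaryMap f hC)

instance (μ : PMF Γ) (f : ι → Γ → ℝ) {C : ℝ} (hC : -C ≤ C) :
    IsProbabilityMeasure (hittingMeasure μ f hC) :=
  Measure.isProbabilityMeasure_map (measurable_boundaryMap f hC).aemeasurable

variable [Countable ι]

/-- Split according to the first increment: the limit point is `s₀` applied to the limit point of
the shifted path, which is independent of `s₀` and has the same law. -/
theorem hittingMeasure_stationary (μ : PMF Γ) (f : ι → Γ → ℝ) {C : ℝ} (hC : -C ≤ C) :
    Measure.sum (fun g : Γ => μ g • (hittingMeasure μ f hC).map (fun z => g • z)) =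
      hittingMeasure μ f hC := by
  have hb := measurable_boundaryMap f hC
  have hfut := measurePreserving_futureIncrements μ 1
  ext A hA
  rw [Measure.sum_apply _ hA, hittingMeasure, Measure.map_apply hb hA]
  have hgA : ∀ g : Γ, MeasurableSet ((fun s => g • boundaryMap f hC s) ⁻¹' A) := fun g =>
    ((measurable_const_smul g).comp hb) hA
  have hfirst : ∀ g : Γ, MeasurableSet[incrementFiltration Γ 1] {s : ℕ → Γ | s 0 = g} := fun g =>
    measurable_increment zero_lt_one (measurableSet_singleton g)
  have h1 : boundaryMap f hC ⁻¹' A = ⋃ g : Γ, (futureIncrements 1 ⁻¹'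
      ((fun s => g • boundaryMap f hC s) ⁻¹' A) ∩ {s : ℕ → Γ | s 0 = g}) := by
    ext s
    have : walkPosition s 1 = s 0 := by simp [walkPosition]
    simp [boundaryMap_eq_smul f hC 1 s, this]
  rw [h1, measure_iUnion]
  · refine tsum_congr fun g => ?_
    rw [ProbabilityTheory.Indep_iff _ _ _ |>.1 (indep_future_past μ 1) _ _ ⟨_, hgA g, rfl⟩ (hfirst g),
      hfut.measure_preimage (hgA g).nullMeasurableSet, Measure.smul_apply, smul_eq_mul, mul_comm,
      Measure.map_map (measurable_const_smul g) hb,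
      Measure.map_apply ((measurable_const_smul g).comp hb) hA]
    have h2 : incrementMeasure μ {s : ℕ → Γ | s 0 = g} = μ g := by
      have h3 := (measurePreserving_eval_infinitePi (fun _ : ℕ => μ.toMeasure) 0).measure_preimage
        (measurableSet_singleton g).nullMeasurableSet
      rw [PMF.toMeasure_apply_singleton _ _ (measurableSet_singleton g)] at h3
      exact h3
    rw [h2]
    rfl
  · intro g g' hgg'
    refine Set.disjoint_left.2 fun s hs hs' => hgg' ?_
    exact (show s 0 = g from hs.2).symm.trans hs'.2
  · exact fun g => (hfut.measurable (hgA g)).inter ((incrementFiltration Γ).le 1 _ (hfirst g))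

/-- By the Markov property the `n`-th integral is the conditional expectation of `φ` at the limit
point given the first `n` increments; Lévy's upward theorem applies. -/
theorem ae_tendsto_integral_boundaryMap (μ : PMF Γ) (f : ι → Γ → ℝ) {C : ℝ} (hC : -C ≤ C)
    (φ : C(FunctionSpace ι Γ C, ℝ)) :
    ∀ᵐ s ∂(incrementMeasure μ),
      Tendsto (fun n => ∫ y, φ (walkPosition s n • y) ∂(hittingMeasure μ f hC)) atTop
        (𝓝 (φ (boundaryMap f hC s))) := by
  have hb := measurable_boundaryMap f hC
  have hG : ∀ g : Γ, Measurable fun s => φ (g • boundaryMap f hC s) := fun g =>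
    φ.continuous.measurable.comp ((measurable_const_smul g).comp hb)
  have hφb : Measurable fun s => φ (boundaryMap f hC s) := φ.continuous.measurable.comp hb
  have h1 : ∀ n, (incrementMeasure μ)[fun s => φ (boundaryMap f hC s) | incrementFiltration Γ n]
      =ᵐ[incrementMeasure μ]
        fun s => ∫ y, φ (walkPosition s n • y) ∂(hittingMeasure μ f hC) := fun n => by
    have h2 := condExp_markov μ hG (fun g s => φ.norm_coe_le_norm (g • boundaryMap f hC s)) n
    simp only [← boundaryMap_eq_smul] at h2
    refine h2.trans (Eventually.of_forall fun s => ?_)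
    exact (integral_map hb.aemeasurable (φ.continuous.measurable.comp
      (measurable_const_smul (walkPosition s n))).aestronglyMeasurable).symm
  have h3 := tendsto_ae_condExp (μ := incrementMeasure μ) (ℱ := incrementFiltration Γ)
    fun s => φ (boundaryMap f hC s)
  rw [iSup_incrementFiltration, condExp_of_stronglyMeasurable le_rfl hφb.stronglyMeasurable
    (Integrable.of_bound (C := ‖φ‖) hφb.aestronglyMeasurable
      (Eventually.of_forall fun s => φ.norm_coe_le_norm _))] at h3
  filter_upwards [h3, ae_all_iff.2 h1] with s hs hs'
  simpa only [hs'] using hs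

/-- Separability of `C(K)` yields one null set for all test functions. -/
theorem ae_tendsto_dirac_boundaryMap (μ : PMF Γ) (f : ι → Γ → ℝ) {C : ℝ} (hC : -C ≤ C) :
    ∀ᵐ s ∂(incrementMeasure μ), ∀ φ : C(FunctionSpace ι Γ C, ℝ),
      Tendsto (fun n => ∫ y, φ (walkPosition s n • y) ∂(hittingMeasure μ f hC)) atTop
        (𝓝 (φ (boundaryMap f hC s))) := by
  let D := TopologicalSpace.denseSeq C(FunctionSpace ι Γ C, ℝ)
  filter_upwards [ae_all_iff.2 fun i => ae_tendsto_integral_boundaryMap μ f hC (D i)] with s hs φ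
  rw [Metric.tendsto_atTop]
  intro ε hε
  obtain ⟨i, hi⟩ := (TopologicalSpace.denseRange_denseSeq
    C(FunctionSpace ι Γ C, ℝ)).exists_dist_lt φ (ε := ε / 3) (by positivity)
  obtain ⟨N, hN⟩ := Metric.tendsto_atTop.1 (hs i) (ε / 3) (by positivity)
  refine ⟨N, fun n hn => ?_⟩
  have hint : ∀ ψ : C(FunctionSpace ι Γ C, ℝ), Integrable
      (fun y => ψ (walkPosition s n • y)) (hittingMeasure μ f hC) := fun ψ =>
    Integrable.of_bound (C := ‖ψ‖) (ψ.continuous.measurable.comp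
      (measurable_const_smul (walkPosition s n))).aestronglyMeasurable
      (Eventually.of_forall fun y => ψ.norm_coe_le_norm _)
  have h1 : dist (∫ y, φ (walkPosition s n • y) ∂(hittingMeasure μ f hC))
      (∫ y, D i (walkPosition s n • y) ∂(hittingMeasure μ f hC)) ≤ ε / 3 := by
    rw [dist_eq_norm, ← integral_sub (hint φ) (hint (D i))]
    refine (norm_integral_le_of_norm_le_const (C := ε / 3)
      (Eventually.of_forall fun y => ?_)).trans (by simp)
    rw [← dist_eq_norm]
    exact (ContinuousMap.dist_apply_le_dist _).trans hi.le
  have h2 : dist (D i (boundaryMap f hC s)) (φ (boundaryMap f hC s)) < ε / 3 := by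
    rw [dist_comm]
    exact (ContinuousMap.dist_apply_le_dist _).trans_lt hi
  have h3 := hN n hn
  calc _ ≤ _ := dist_triangle4 _ (∫ y, D i (walkPosition s n • y) ∂(hittingMeasure μ f hC))
        (D i (boundaryMap f hC s)) _
    _ < ε / 3 + ε / 3 + ε / 3 := add_lt_add (add_lt_add_of_le_of_lt h1 h3) h2
    _ = ε := by ring

/-- Harmonicity turns the limsups into limits almost surely, so the witness inequality at `h = ω_n`
passes to the boundary values. -/
theorem ae_hittingMeasure_witness (μ : PMF Γ) {F : Finset Γ} {f : F → Γ → ℝ} {C δ : ℝ}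
    (hC : -C ≤ C) (hf : ∀ g h, |f g h| ≤ C) (hδ : ∀ h : Γ, δ ≤ ∑ g : F, (f g (g * h) - f g h))
    (hh : ∀ g h, markovOperator μ (f g) h = f g h) :
    ∀ᵐ z ∂(hittingMeasure μ f hC), δ ≤ ∑ g : F, ((z (g, (g : Γ)) : ℝ) - (z (g, 1) : ℝ)) := by
  have hmeas : ∀ p : F × Γ, Measurable fun z : FunctionSpace F Γ C => (z p : ℝ) := fun p =>
    measurable_subtype_coe.comp
      (measurable_pi_apply (X := fun _ : F × Γ => Set.Icc (-C) C) p)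
  have hset : MeasurableSet {z : FunctionSpace F Γ C |
      δ ≤ ∑ g : F, ((z (g, (g : Γ)) : ℝ) - (z (g, 1) : ℝ))} :=
    measurableSet_le measurable_const
      (Finset.measurable_fun_sum _ fun g _ => (hmeas (g, (g : Γ))).sub (hmeas (g, 1)))
  refine (ae_map_iff (measurable_boundaryMap f hC).aemeasurable hset).2 ?_
  filter_upwards [ae_all_iff.2 fun g => ae_all_iff.2 fun k =>
    ae_tendsto_harmonic μ (hf g) (hh g) k] with s hs
  have hlim : ∀ (g : F) (k : Γ), Tendsto (fun n => f g (k * walkPosition s n)) atTop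
      (𝓝 (boundaryMap f hC s (g, k) : ℝ)) := by
    intro g k
    obtain ⟨c, hc⟩ := hs g k
    have hcI : c ∈ Set.Icc (-C) C :=
      isClosed_Icc.mem_of_tendsto hc (Eventually.of_forall fun n => abs_le.1 (hf g _))
    have : (boundaryMap f hC s (g, k) : ℝ) = c := by
      simp only [boundaryMap, hc.limsup_eq]
      rw [Set.projIcc_of_mem hC hcI]
    rwa [this]
  refine ge_of_tendsto (tendsto_finsetSum (Finset.univ : Finset F) fun g _ =>
    (hlim g g).sub (hlim g 1)) (Eventually.of_forall fun n => ?_)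
  simpa using hδ (walkPosition s n)

end Walk

/-! ### The Poisson boundary -/

theorem ae_not_fixed_of_isPoissonBoundary {Γ : Type u} [Group Γ] [Countable Γ] {μ : PMF Γ}
    (hμ : IsGenerating μ) {X : Type v} [MeasurableSpace X] [MulAction Γ X] (ν : Measure X)
    (hν : IsPoissonBoundary μ ν) (F : Finset Γ) (hF : HasNonamenabilityWitness F) :
    ∀ᵐ x ∂ν, ¬ ∀ g ∈ F, g • x = x := by
  let _ : MeasurableSpace Γ := ⊤
  have _ : DiscreteMeasurableSpace Γ := ⟨fun _ => trivial⟩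
  obtain ⟨f, C, δ, hf, hδ, hδf, hh⟩ := hF.exists_harmonic μ
  obtain ⟨g₀⟩ : Nonempty F := by
    by_contra hemp
    rw [not_nonempty_iff] at hemp
    have := hδf 1
    rw [Finset.univ_eq_empty, Finset.sum_empty] at this
    linarith
  have hC : -C ≤ C := by
    have := (abs_nonneg _).trans (hf g₀ 1)
    linarith
  have hb : IsCompactMuBoundary μ (hittingMeasure μ f hC) :=
    ⟨isStationaryAction_of_isGenerating hμ _ (hittingMeasure_stationary μ f hC), by
      filter_upwards [ae_tendsto_dirac_boundaryMap μ f hC] with s hs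
      exact ⟨_, hs⟩⟩
  -- Maximality is used here. If `gx = x`, then `z = φ x` satisfies `gz = z`, so `z(g, g) = z(g,
  -- 1)`, and the sum bounded below by `δ` vanishes.
  obtain ⟨φ, hφ, hmap, hequiv⟩ := hν.2 (FunctionSpace F Γ C) (hittingMeasure μ f hC) hb
  have hw := ae_hittingMeasure_witness μ hC hf hδf hh
  rw [← hmap] at hw
  filter_upwards [ae_of_ae_map hφ.aemeasurable hw, ae_all_iff.2 hequiv] with x hx hx' hfix
  have hz : ∀ g : F, φ x (g, (g : Γ)) = φ x (g, 1) := fun g => by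
    have h1 := hx' g
    rw [hfix g g.2] at h1
    conv_rhs => rw [h1, FunctionSpace.smul_apply, one_mul]
  simp only [hz, sub_self, Finset.sum_const_zero] at hx
  linarith

/-- Fixed-point sets in the compact metrizable model are Borel. Their preimages agree with those in
`X` modulo null sets, since the isomorphism is equivariant and invertible at almost every `x`, and
by non-singularity also at `gx`. -/
theorem IsMuBoundary.hasMeasurableStabilizers {Γ : Type u} [Group Γ] {μ : PMF Γ} {X : Type v}
    [MeasurableSpace X] [MulAction Γ X] [MeasurableConstSMul Γ X] {ν : Measure X}
    (hν : IsMuBoundary μ ν) : HasMeasurableStabilizers Γ ν := by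
  obtain ⟨hst, K, _, _, _, _, _, _, _, κ, _, -, φ, ψ, hφ, -, hψφ, -⟩ := hν
  intro g
  let _ := TopologicalSpace.metrizableSpaceMetric K
  have h1 : MeasurableSet {y : K | g • y = y} :=
    measurableSet_eq_fun (measurable_const_smul g) measurable_id
  have hq : Measure.QuasiMeasurePreserving (fun x : X => g • x) ν ν :=
    ⟨measurable_const_smul g, hst.map_ac g⟩
  refine (hφ.measurable h1).nullMeasurableSet.congr (Filter.eventuallyEq_set.2 ?_)
  filter_upwards [hφ.equivariant g, hψφ, hq.ae hψφ] with x h2 h3 h4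
  change g • φ x = φ x ↔ g • x = x
  refine ⟨fun h => ?_, fun h => ?_⟩
  · rw [← h4, h2, h, h3]
  · rw [← h2, h]

theorem theorem5p3 {Γ : Type u} [Group Γ] [Countable Γ] (μ : PMF Γ)
    (hμ : IsCStarSimpleMeasure μ) :
    (∀ (X : Type v) [MeasurableSpace X] [MulAction Γ X] [MeasurableConstSMul Γ X]
      (ν : Measure X) [IsProbabilityMeasure ν],
      IsStationaryAction μ ν → HasMeasurableStabilizers Γ ν →
        HasAmenableStabilizers Γ ν → IsEssentiallyFree Γ ν) ∧
    (∀ (X : Type v) [MeasurableSpace X] [MulAction Γ X] [MeasurableConstSMul Γ X]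
      (ν : Measure X) [IsProbabilityMeasure ν],
      IsStationaryAction μ ν → HasMeasurableStabilizers Γ ν →
        IsZimmerAmenable Γ ν → IsEssentiallyFree Γ ν) ∧
    (IsGenerating μ →
      ∀ (X : Type v) [MeasurableSpace X] [MulAction Γ X] [MeasurableConstSMul Γ X]
        (ν : Measure X) [IsProbabilityMeasure ν],
        IsPoissonBoundary μ ν → IsEssentiallyFree Γ ν) := by
  refine ⟨?_, ?_, ?_⟩
  · intro X _ _ _ ν _ hν hm ha
    exact isEssentiallyFree_of_almostInvariantVectors μ hμ ν hν hm
      (ae_hasAlmostInvariantVectors ν (ae_not_fixed_of_amenableStabilizers ν ha))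
  · intro X _ _ _ ν _ hν hm ha
    exact isEssentiallyFree_of_almostInvariantVectors μ hμ ν hν hm
      (ae_hasAlmostInvariantVectors ν (ae_not_fixed_of_zimmerAmenable ν hν.map_ac ha))
  · intro hgen X _ _ _ ν _ hν
    exact isEssentiallyFree_of_almostInvariantVectors μ hμ ν hν.1.1
      hν.1.hasMeasurableStabilizers
      (ae_hasAlmostInvariantVectors ν (ae_not_fixed_of_isPoissonBoundary hgen ν hν))
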